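/- **Setting.** Let $n\ge 1$, $\theta\in\mathbb R^n$, and let $Y_i=\theta_i+\epsilon_i$, $i=1,\dots,n$, where $\epsilon_1,\dots,\epsilon_n$ are independent, mean-zero and sub-Gaussian: $\mathbb E[e^{t\epsilon_i}]\le e^{t^2/2}$ for all $t\in\mathbb R$. A *change-point vector* is a vector $\tau=(\tau_1,\dots,\tau_{|\tau|})$ of integers (possibly empty) with $1=\tau_0<\tau_1<\dots<\tau_{|\tau|}<\tau_{|\tau|+1}=n+1$. Let $\tau^*=(\tau^*_1,\dots,\tau^*_K)$ be the change-point vector of $\theta$, that is, $\theta_i=\mu_k$ for $\tau^*_{k-1}\le i<\tau^*_k$ ($1\le k\le K+1$) with $\mu_k\ne\mu_{k+1}$, and let $\Delta_k=\mu_{k+1}-\mu_k$ be the height of its $k$-th change-point. For integers $1\le t_1<t_2<t_3\le n+1$ and $q>0$ put $$\psi_q(t_1,t_2,t_3)=\sqrt{2\log\Big(\frac{n(t_3-t_1)}{(t_3-t_2)(t_2-t_1)}\Big)+q},\qquad \mathbf C(y,t)=\Big[\frac{\sum_{i=t_2}^{t_3-1}y_i}{t_3-t_2}-\frac{\sum_{i=t_1}^{t_2-1}y_i}{t_2-t_1}\Big]\sqrt{\frac{(t_2-t_1)(t_3-t_2)}{t_3-t_1}}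 .$$ The change-point $\tau^*_k$ has *$(\kappa,q)$-high energy* if $|\mathbf C(\theta,(\tau^*_{k-1},\tau^*_k,\tau^*_{k+1}))|>\kappa\,\psi_q(\tau^*_{k-1},\tau^*_k,\tau^*_{k+1})$. Let $\mathcal A_q$ be the event that $|\mathbf C(\epsilon,t)|\le 2\psi_q(t)$ for all triads $t=(t_1,t_2,t_3)$ with $1\le t_1<t_2<t_3\le n+1$. The penalized least-squares estimator $\widehat\tau$ with parameters $L$ and $q$ is any minimizer, over all change-point vectors $\tau$, of $$\|Y-\Pi_\tau Y\|^2+L\Big[q|\tau|+2\sum_{i=1}^{|\tau|+1}\log\Big(\frac{n}{\tau_i-\tau_{i-1}}\Big)\Big],$$ where $\Pi_\tau$ is the orthogonal projection onto the vectors that are constant on each $\{\tau_{i-1},\dots,\tau_i-1\}$. Finally $d_{H,1}(\tau,s)=\min_{1\le l\le|\tau|}|\tau_l-s|$ (equal to $+\infty$ if $\tau$ is empty). **Proposition.** There exist universal constants $L_0>1$, $q_0>0$, $c>0$, $c'>0$ and, for each $L$, a constant $\kappa_L>1$ depending only on $L$, such that for all $L\ge L_0$, $q>q_0$, $n\ge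 1$, all $\theta\in\mathbb R^n$, all noise distributions as above, and every $(\kappa_L,q)$-high-energy change-point $\tau^*_k$ of $\theta$, the penalized least-squares estimator $\widehat\tau$ with parameters $L$ and $q$ satisfies $$\mathbb P\big(d_{H,1}(\widehat\tau,\tau^*_k)\,\mathbf 1_{\mathcal A_q}\ge c\,x\,\Delta_k^{-2}\big)\le c'e^{-x}\qquad\text{for all }x\ge 1 .$$ -/

import Mathlib

open MeasureTheory ProbabilityTheory
open scoped ENNReal

noncomputable section

namespace ChangePoint

/-- A change-point vector `(τ₁, …, τ_len)` of integers, stored together with the two conventional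
end points: `1 = τ₀ < τ₁ < ⋯ < τ_len < τ_{len+1} = n + 1`. -/
structure CPVector (n : ℕ) where
  len : ℕ
  pt : Fin (len + 2) → ℕ
  strictMono : StrictMono pt
  pt_zero : pt 0 = 1
  pt_last : pt (Fin.last (len + 1)) = n + 1

namespace CPVector

variable {n : ℕ} (τ : CPVector n)

/-- The change-point `τ_{k+1}`, for `k = 0, …, len - 1`. -/
def cp (k : Fin τ.len) : ℕ := τ.pt k.castSucc.succ

/-- The left neighbour of `cp k`. -/
def prev (k : Fin τ.len) : ℕ := τ.pt k.castSucc.castSucc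

/-- The right neighbour of `cp k`. -/
def next (k : Fin τ.len) : ℕ := τ.pt k.succ.succ

/-- The coordinate `i : Fin n`, that is the time `i + 1` of `{1, …, n}`, lies in the `j`-th segment
of `τ`, the integer interval from `pt j` (included) to `pt (j + 1)` (excluded). -/
def InSegment (j : Fin (τ.len + 1)) (i : Fin n) : Prop :=
  τ.pt j.castSucc ≤ (i : ℕ) + 1 ∧ (i : ℕ) + 1 < τ.pt j.succ

/-- The space of vectors that are constant on each segment of `τ`. -/
def pieceSpace : Submodule ℝ (EuclideanSpace ℝ (Fin n)) where
  carrier := {v | ∀ j i i', τ.InSegment j i → τ.InSegment j i' → v i = v i'}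
  add_mem' := by
    intro a b ha hb j i i' h h'
    simp [ha j i i' h h', hb j i i' h h']
  zero_mem' := by
    intro j i i' _ _
    rfl
  smul_mem' := by
    intro c a ha j i i' h h'
    simp [ha j i i' h h']

/-- The multiscale penalty `q |τ| + 2 ∑ log (n / (τ_i - τ_{i-1}))`. -/
def penalty (q : ℝ) : ℝ :=
  q * (τ.len : ℝ) +
    2 * ∑ j : Fin (τ.len + 1),
      Real.log ((n : ℝ) / ((τ.pt j.succ : ℝ) - (τ.pt j.castSucc : ℝ)))

/-- The penalized least-squares criterion `‖Y - Π_τ Y‖² + L pen(τ, q)`. -/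
def criterion (L q : ℝ) (Y : EuclideanSpace ℝ (Fin n)) : ℝ :=
  ‖Y - τ.pieceSpace.starProjection Y‖ ^ 2 + L * τ.penalty q

/-- The distance from `s` to the closest change-point of `τ`; it is `∞` if `τ` has none. -/
def dist1 (s : ℕ) : ℝ≥0∞ :=
  ⨅ l : Fin τ.len, ENNReal.ofReal |(τ.cp l : ℝ) - (s : ℝ)|

end CPVector

variable {n : ℕ}

/-- `τ` minimizes the penalized least-squares criterion over all change-point vectors. -/
def IsPenalizedLSE (L q : ℝ) (Y : EuclideanSpace ℝ (Fin n)) (τ : CPVector n) : Prop :=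
  ∀ σ : CPVector n, τ.criterion L q Y ≤ σ.criterion L q Y

/-- `τ` is the vector of change-points of `θ` and `μ` the vector of its successive values, with
consecutive values distinct. -/
def IsChangePointRep (θ : EuclideanSpace ℝ (Fin n)) (τ : CPVector n)
    (μ : Fin (τ.len + 1) → ℝ) : Prop :=
  (∀ k : Fin τ.len, μ k.castSucc ≠ μ k.succ) ∧
    ∀ j i, τ.InSegment j i → θ i = μ j

/-- The mean of the coordinates of `y` at the times `a, …, b - 1`. -/
def segMean (y : EuclideanSpace ℝ (Fin n)) (a b : ℕ) : ℝ :=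
  (∑ i : Fin n, if a ≤ (i : ℕ) + 1 ∧ (i : ℕ) + 1 < b then y i else 0) / ((b : ℝ) - (a : ℝ))

/-- The CUSUM statistic of `y` at the triad `(t₁, t₂, t₃)`. -/
def cusum (y : EuclideanSpace ℝ (Fin n)) (t₁ t₂ t₃ : ℕ) : ℝ :=
  (segMean y t₂ t₃ - segMean y t₁ t₂) *
    √((((t₂ : ℝ) - t₁) * ((t₃ : ℝ) - t₂)) / ((t₃ : ℝ) - t₁))

/-- The energy of `θ` at the triad `(t₁, t₂, t₃)`. -/
def energy (θ : EuclideanSpace ℝ (Fin n)) (t₁ t₂ t₃ : ℕ) : ℝ :=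
  |segMean θ t₂ t₃ - segMean θ t₁ t₂| *
    √((((t₂ : ℝ) - t₁) * ((t₃ : ℝ) - t₂)) / ((t₃ : ℝ) - t₁))

/-- `√(2 log (n (t₃ - t₁) / ((t₃ - t₂) (t₂ - t₁))) + q)`. -/
def threshold (n : ℕ) (q : ℝ) (t₁ t₂ t₃ : ℕ) : ℝ :=
  √(2 * Real.log (((n : ℝ) * ((t₃ : ℝ) - t₁)) / (((t₃ : ℝ) - t₂) * ((t₂ : ℝ) - t₁))) + q)

/-- The `k`-th change-point of `θ` (with change-point vector `τ`) has `(κ, q)`-high energy. -/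
def IsHighEnergy (κ q : ℝ) (θ : EuclideanSpace ℝ (Fin n)) (τ : CPVector n)
    (k : Fin τ.len) : Prop :=
  κ * threshold n q (τ.prev k) (τ.cp k) (τ.next k) < energy θ (τ.prev k) (τ.cp k) (τ.next k)

/-- The noise vector at the sample point `ω`. -/
def noiseVec {Ω : Type*} (ε : Fin n → Ω → ℝ) (ω : Ω) : EuclideanSpace ℝ (Fin n) :=
  WithLp.toLp 2 fun i => ε i ω

/-- The event that the CUSUM statistics of the noise are at most twice the threshold, simultaneously
over all triads `1 ≤ t₁ < t₂ < t₃ ≤ n + 1`. -/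
def noiseEvent {Ω : Type*} (ε : Fin n → Ω → ℝ) (q : ℝ) : Set Ω :=
  {ω | ∀ t₁ t₂ t₃ : ℕ, 1 ≤ t₁ → t₁ < t₂ → t₂ < t₃ → t₃ ≤ n + 1 →
    |cusum (noiseVec ε ω) t₁ t₂ t₃| ≤ 2 * threshold n q t₁ t₂ t₃}

end ChangePoint

end

/-!
Write the data and the noise through their partial sums `F` and `E`. The penalized criterion is
then a sum of costs of segments, and a minimizer cannot be improved by inserting, deleting or
moving a node, nor by merging two neighbouring nodes into one. At a high-energy change-point `s`,
the signal dominates the penalty on a window around `s`, and on the event `𝒜_q` the noise is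
dominated by the penalty. Inserting nodes around `s` then shows that the minimizer has a node `t` in
the window. If `t` is the nearer of the two neighbours of `s`, moving it to `s` (or, when the other
neighbour is close as well, merging both into `s`) is an improvement unless the slope
`|E t - E s| / |t - s|` of the noise, or a slope at a larger distance from `s`, exceeds a fixed
fraction of the jump `|Δ|`. So the distance from `t` to `s` is controlled by the last time at which
the random walk `E p - E s` leaves a cone of slope `|Δ| / 16`, and Ville's inequality for its
exponential martingale bounds the tail of that distance by `exp (-x)` on the scale `Δ⁻²`.
-/

noncomputable section

open scoped Pointwise NNReal

namespace ChangePoint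

/-- The mean over the times `a, …, b - 1` of the sequence whose partial sums are `F`. -/
def avg (F : ℤ → ℝ) (a b : ℤ) : ℝ := (F b - F a) / ((b : ℝ) - a)

/-- The squared norm of the projection of the sequence with partial sums `F` onto the indicator of
the times `a, …, b - 1`. It is `0` for `a = b`, by division by zero. -/
def explained (F : ℤ → ℝ) (a b : ℤ) : ℝ := (F b - F a) ^ 2 / ((b : ℝ) - a)

/-- The square of the CUSUM statistic at the triad `(a, b, c)`, in terms of partial sums: the part
of the norm that is explained by a change of mean at `b`. -/
def cusumSq (F : ℤ → ℝ) (a b c : ℤ) : ℝ :=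
  explained F a b + explained F b c - explained F a c

/-- The square of the threshold `ψ_q`, with the logarithm split. -/
def thresholdSq (n q : ℝ) (a b c : ℤ) : ℝ :=
  q + 2 * (Real.log n + Real.log ((c : ℝ) - a) - Real.log ((c : ℝ) - b) - Real.log ((b : ℝ) - a))

/-- The contribution of the segment `a, …, b - 1` to the penalized criterion. -/
def segCost (F : ℤ → ℝ) (n L q : ℝ) (a b : ℤ) : ℝ :=
  -explained F a b + L * (q + 2 * Real.log (n / ((b : ℝ) - a)))

/-- The partial sums of the sequence read backwards in time. It exchanges the two sides of a
change-point. -/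
def reflect (F : ℤ → ℝ) : ℤ → ℝ := fun p => -F (-p)

section SegmentStatistics

variable {F : ℤ → ℝ} {n L q : ℝ} {a b c : ℤ}

section Reflection

lemma avg_reflect (F : ℤ → ℝ) (a b : ℤ) : avg (reflect F) a b = avg F (-b) (-a) := by
  unfold avg reflect
  push_cast
  congr 1 <;> ring

lemma explained_reflect (F : ℤ → ℝ) (a b : ℤ) :
    explained (reflect F) a b = explained F (-b) (-a) := by
  unfold explained reflect
  push_cast
  congr 1 <;> ring

lemma cusumSq_reflect (F : ℤ → ℝ) (a b c : ℤ) :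
    cusumSq (reflect F) a b c = cusumSq F (-c) (-b) (-a) := by
  simp only [cusumSq, explained_reflect]
  ring

lemma segCost_reflect (F : ℤ → ℝ) (n L q : ℝ) (a b : ℤ) :
    segCost (reflect F) n L q a b = segCost F n L q (-b) (-a) := by
  simp only [segCost, explained_reflect, Int.cast_neg, neg_sub_neg]

lemma thresholdSq_neg (n q : ℝ) (a b c : ℤ) :
    thresholdSq n q (-c) (-b) (-a) = thresholdSq n q a b c := by
  simp only [thresholdSq, Int.cast_neg, neg_sub_neg]
  ring

end Reflection

lemma sub_cast_pos (h : a < b) : (0 : ℝ) < (b : ℝ) - a :=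
  sub_pos.2 (by exact_mod_cast h)

section Cusum

lemma cusumSq_eq (F : ℤ → ℝ) (hab : a < b) (hbc : b < c) :
    cusumSq F a b c =
      (avg F b c - avg F a b) ^ 2 * (((b : ℝ) - a) * ((c : ℝ) - b) / ((c : ℝ) - a)) := by
  have hx := sub_cast_pos hab
  have hy := sub_cast_pos hbc
  rw [cusumSq, explained, explained, explained, avg, avg,
    show (c : ℝ) - a = ((b : ℝ) - a) + ((c : ℝ) - b) by ring]
  generalize (b : ℝ) - a = x at *
  generalize (c : ℝ) - b = y at *
  field_simp
  ring

lemma cusumSq_nonneg (F : ℤ → ℝ) (hab : a < b) (hbc : b < c) : 0 ≤ cusumSq F a b c := by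
  rw [cusumSq_eq F hab hbc]
  have hx := sub_cast_pos hab
  have hy := sub_cast_pos hbc
  have hxy := sub_cast_pos (hab.trans hbc)
  positivity

lemma explained_le_add (F : ℤ → ℝ) (hab : a ≤ b) (hbc : b ≤ c) :
    explained F a c ≤ explained F a b + explained F b c := by
  rcases hab.eq_or_lt with rfl | hab
  · simp [explained]
  rcases hbc.eq_or_lt with rfl | hbc
  · simp [explained]
  exact sub_nonneg.1 (cusumSq_nonneg F hab hbc)

lemma avg_sub_avg_left (F : ℤ → ℝ) (hab : a < b) (hbc : b < c) :
    avg F a c - avg F a b = (avg F b c - avg F a b) * (((c : ℝ) - b) / ((c : ℝ) - a)) := by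
  have hx := sub_cast_pos hab
  have hy := sub_cast_pos hbc
  rw [avg, avg, avg, show (c : ℝ) - a = ((b : ℝ) - a) + ((c : ℝ) - b) by ring]
  generalize (b : ℝ) - a = x at *
  generalize (c : ℝ) - b = y at *
  field_simp
  ring

lemma sq_avg_sub_left_le (F : ℤ → ℝ) (hab : a < b) (hbc : b < c) :
    (avg F a c - avg F a b) ^ 2 * ((b : ℝ) - a) ≤ cusumSq F a b c := by
  have hx := sub_cast_pos hab
  have hxy := sub_cast_pos (hab.trans hbc)
  have hweight : ((c : ℝ) - b) / ((c : ℝ) - a) ≤ 1 := by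
    rw [div_le_one hxy]
    linarith
  calc (avg F a c - avg F a b) ^ 2 * ((b : ℝ) - a)
      = cusumSq F a b c * (((c : ℝ) - b) / ((c : ℝ) - a)) := by
        rw [avg_sub_avg_left F hab hbc, cusumSq_eq F hab hbc]
        ring
    _ ≤ cusumSq F a b c := mul_le_of_le_one_right (cusumSq_nonneg F hab hbc) hweight

lemma sq_avg_sub_right_le (F : ℤ → ℝ) (hab : a < b) (hbc : b < c) :
    (avg F a c - avg F b c) ^ 2 * ((c : ℝ) - b) ≤ cusumSq F a b c := by
  have h := sq_avg_sub_left_le (reflect F) (neg_lt_neg hbc) (neg_lt_neg hab)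
  simpa only [avg_reflect, cusumSq_reflect, neg_neg, Int.cast_neg, neg_sub_neg] using h

lemma cusumSq_le_left (F : ℤ → ℝ) (hab : a < b) (hbc : b < c) :
    cusumSq F a b c ≤ (avg F b c - avg F a b) ^ 2 * ((b : ℝ) - a) := by
  have hx := sub_cast_pos hab
  rw [cusumSq_eq F hab hbc]
  refine mul_le_mul_of_nonneg_left ?_ (sq_nonneg _)
  rw [div_le_iff₀ (sub_cast_pos (hab.trans hbc))]
  exact mul_le_mul_of_nonneg_left (by linarith) hx.le

lemma cusumSq_le_right (F : ℤ → ℝ) (hab : a < b) (hbc : b < c) :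
    cusumSq F a b c ≤ (avg F b c - avg F a b) ^ 2 * ((c : ℝ) - b) := by
  have h := cusumSq_le_left (reflect F) (neg_lt_neg hbc) (neg_lt_neg hab)
  rw [sub_sq_comm]
  simpa only [avg_reflect, cusumSq_reflect, neg_neg, Int.cast_neg, neg_sub_neg] using h

lemma mul_add_le_two_mul_mul {x y d : ℝ} (hx : 0 ≤ x) (hy : 0 ≤ y) (hdx : d ≤ x) (hdy : d ≤ y) :
    d * (x + y) ≤ 2 * (x * y) := by
  linarith [mul_le_mul_of_nonneg_right hdx hy, mul_le_mul_of_nonneg_right hdy hx]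

lemma sq_avg_sub_avg_mul_le (F : ℤ → ℝ) (hab : a < b) (hbc : b < c) {d : ℝ}
    (hda : d ≤ (b : ℝ) - a) (hdc : d ≤ (c : ℝ) - b) :
    (avg F b c - avg F a b) ^ 2 * d ≤ 2 * cusumSq F a b c := by
  have h := mul_add_le_two_mul_mul (sub_cast_pos hab).le (sub_cast_pos hbc).le hda hdc
  have hd : d ≤ 2 * (((b : ℝ) - a) * ((c : ℝ) - b) / ((c : ℝ) - a)) := by
    rw [← mul_div_assoc, le_div_iff₀ (sub_cast_pos (hab.trans hbc))]
    linarith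
  rw [cusumSq_eq F hab hbc]
  linarith [mul_le_mul_of_nonneg_left hd (sq_nonneg (avg F b c - avg F a b))]

end Cusum

section Threshold

lemma le_thresholdSq (n q : ℝ) (hab : a < b) (hbc : b < c) :
    q + 2 * (Real.log n - Real.log ((b : ℝ) - a)) ≤ thresholdSq n q a b c := by
  have hx := sub_cast_pos hab
  have h := Real.log_le_log (sub_cast_pos hbc) (show (c : ℝ) - b ≤ (c : ℝ) - a by linarith)
  rw [thresholdSq]
  linarith

lemma thresholdSq_le (n q : ℝ) (hab : a < b) (hbc : b < c) {d : ℝ} (hd : 0 < d)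
    (hda : d ≤ (b : ℝ) - a) (hdc : d ≤ (c : ℝ) - b) :
    thresholdSq n q a b c ≤ q + 2 * (Real.log n - Real.log d) + 2 * Real.log 2 := by
  have hx := sub_cast_pos hab
  have hy := sub_cast_pos hbc
  have hxy := sub_cast_pos (hab.trans hbc)
  have h := mul_add_le_two_mul_mul hx.le hy.le hda hdc
  rw [show (b : ℝ) - a + ((c : ℝ) - b) = (c : ℝ) - a by ring] at h
  have hlog := Real.log_le_log (by positivity) h
  rw [Real.log_mul hd.ne' hxy.ne', Real.log_mul two_ne_zero (by positivity),
    Real.log_mul hx.ne' hy.ne'] at hlog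
  rw [thresholdSq]
  linarith

end Threshold

section SegCost

lemma segCost_eq (F : ℤ → ℝ) (L q : ℝ) (hn : 0 < n) (hab : a < b) :
    segCost F n L q a b =
      -explained F a b + L * (q + 2 * (Real.log n - Real.log ((b : ℝ) - a))) := by
  rw [segCost, Real.log_div hn.ne' (sub_cast_pos hab).ne']

lemma segCost_self (F : ℤ → ℝ) (n L q : ℝ) (a : ℤ) : segCost F n L q a a = L * q := by
  simp [segCost, explained]

lemma segCost_add_sub (F : ℤ → ℝ) (L q : ℝ) (hn : 0 < n) (hab : a < b) (hbc : b < c) :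
    segCost F n L q a b + segCost F n L q b c - segCost F n L q a c =
      L * thresholdSq n q a b c - cusumSq F a b c := by
  rw [segCost_eq F L q hn hab, segCost_eq F L q hn hbc, segCost_eq F L q hn (hab.trans hbc),
    thresholdSq, cusumSq]
  ring

end SegCost

lemma log_two_lt : Real.log 2 < 0.7 := by
  linarith [Real.log_two_lt_d9]

lemma log_le_of_le_two_pow_mul {x y : ℝ} (k : ℕ) (hx : 0 < x) (hy : 0 < y)
    (h : x ≤ 2 ^ k * y) : Real.log x ≤ k * 0.7 + Real.log y := by
  have hlog := Real.log_le_log hx h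
  rw [Real.log_mul (by positivity) hy.ne', Real.log_pow] at hlog
  have hk := mul_le_mul_of_nonneg_left log_two_lt.le k.cast_nonneg
  linarith

end SegmentStatistics

/-- `a < b` are consecutive elements of the finite set `N` of nodes. -/
def Consec (N : Finset ℤ) (a b : ℤ) : Prop :=
  a ∈ N ∧ b ∈ N ∧ a < b ∧ ∀ p ∈ N, p ≤ a ∨ b ≤ p

instance (N : Finset ℤ) (a b : ℤ) : Decidable (Consec N a b) := by
  unfold Consec
  infer_instance

namespace Consec

variable {N : Finset ℤ} {u v w : ℤ}

lemma left_mem (h : Consec N u v) : u ∈ N := h.1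

lemma right_mem (h : Consec N u v) : v ∈ N := h.2.1

lemma lt (h : Consec N u v) : u < v := h.2.2.1

lemma le_or_le (h : Consec N u v) {p : ℤ} (hp : p ∈ N) : p ≤ u ∨ v ≤ p := h.2.2.2 p hp

lemma neg (h : Consec N u v) : Consec (-N) (-v) (-u) := by
  refine ⟨by simpa using h.right_mem, by simpa using h.left_mem, neg_lt_neg h.lt, fun p hp => ?_⟩
  have := h.le_or_le (Finset.mem_neg'.1 hp)
  omega

lemma neg_iff : Consec (-N) u v ↔ Consec N (-v) (-u) :=
  ⟨fun h => by simpa using h.neg, fun h => by simpa using h.neg⟩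

lemma insert_of_notMem_Ioo (h : Consec N u v) (hw : w ≤ u ∨ v ≤ w) : Consec (insert w N) u v := by
  refine ⟨Finset.mem_insert_of_mem h.left_mem, Finset.mem_insert_of_mem h.right_mem, h.lt,
    fun p hp => ?_⟩
  rcases Finset.mem_insert.1 hp with rfl | hp
  · exact hw
  · exact h.le_or_le hp

lemma insert_left (h : Consec N u v) (huw : u < w) (hwv : w < v) : Consec (insert w N) u w := by
  refine ⟨Finset.mem_insert_of_mem h.left_mem, Finset.mem_insert_self w N, huw, fun p hp => ?_⟩
  rcases Finset.mem_insert.1 hp with rfl | hp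
  · exact Or.inr le_rfl
  · exact (h.le_or_le hp).imp_right hwv.le.trans

lemma insert_right (h : Consec N u v) (huw : u < w) (hwv : w < v) : Consec (insert w N) w v := by
  refine ⟨Finset.mem_insert_self w N, Finset.mem_insert_of_mem h.right_mem, hwv, fun p hp => ?_⟩
  rcases Finset.mem_insert.1 hp with rfl | hp
  · exact Or.inl le_rfl
  · exact (h.le_or_le hp).imp_left fun hpu => hpu.trans huw.le

lemma erase_of_ne (h : Consec N u v) (hu : u ≠ w) (hv : v ≠ w) : Consec (N.erase w) u v :=
  ⟨Finset.mem_erase.2 ⟨hu, h.left_mem⟩, Finset.mem_erase.2 ⟨hv, h.right_mem⟩, h.lt,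
    fun _ hp => h.le_or_le (Finset.mem_of_mem_erase hp)⟩

lemma erase (h : Consec N u w) (h' : Consec N w v) : Consec (N.erase w) u v := by
  refine ⟨Finset.mem_erase.2 ⟨h.lt.ne, h.left_mem⟩, Finset.mem_erase.2 ⟨h'.lt.ne', h'.right_mem⟩,
    h.lt.trans h'.lt, fun p hp => ?_⟩
  obtain ⟨hpw, hp⟩ := Finset.mem_erase.1 hp
  have := h.le_or_le hp
  have := h'.le_or_le hp
  omega

end Consec

/-- The pairs of consecutive elements of `N`, that is, the segments that `N` delimits. -/
def consecPairs (N : Finset ℤ) : Finset (ℤ × ℤ) := {p ∈ N ×ˢ N | Consec N p.1 p.2}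

/-- The total cost of the segmentation with nodes `N`, when a segment from `a` to `b` costs
`J a b`. -/
def segmentationCost (J : ℤ → ℤ → ℝ) (N : Finset ℤ) : ℝ := ∑ p ∈ consecPairs N, J p.1 p.2

section Cost

variable {J : ℤ → ℤ → ℝ} {N : Finset ℤ} {u v w : ℤ}

lemma mem_consecPairs {p : ℤ × ℤ} : p ∈ consecPairs N ↔ Consec N p.1 p.2 := by
  simp only [consecPairs, Finset.mem_filter, Finset.mem_product, and_iff_right_iff_imp]
  exact fun h => ⟨h.left_mem, h.right_mem⟩

lemma consecPairs_insert (h : Consec N u v) (huw : u < w) (hwv : w < v) :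
    consecPairs (insert w N) = insert (u, w) (insert (w, v) ((consecPairs N).erase (u, v))) := by
  ext ⟨a, b⟩
  simp only [mem_consecPairs, Finset.mem_insert, Finset.mem_erase, Prod.mk.injEq, ne_eq]
  constructor
  · intro hab
    have hu := hab.le_or_le (Finset.mem_insert_of_mem h.left_mem)
    have hv := hab.le_or_le (Finset.mem_insert_of_mem h.right_mem)
    have hw := hab.le_or_le (Finset.mem_insert_self w N)
    have hab_lt := hab.lt
    rcases Finset.mem_insert.1 hab.left_mem with rfl | ha
    · exact Or.inr (Or.inl (by
        have := (Finset.mem_insert.1 hab.right_mem).imp_right h.le_or_le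
        omega))
    rcases Finset.mem_insert.1 hab.right_mem with rfl | hb
    · exact Or.inl (by
        have := h.le_or_le ha
        omega)
    · exact Or.inr (Or.inr ⟨by omega, ha, hb, hab_lt, fun p hp =>
        hab.le_or_le (Finset.mem_insert_of_mem hp)⟩)
  · rintro (⟨rfl, rfl⟩ | ⟨rfl, rfl⟩ | ⟨hne, hab⟩)
    · exact h.insert_left huw hwv
    · exact h.insert_right huw hwv
    · refine hab.insert_of_notMem_Ioo ?_
      have := hab.lt
      have := hab.le_or_le h.left_mem
      have := hab.le_or_le h.right_mem
      have := h.le_or_le hab.left_mem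
      have := h.le_or_le hab.right_mem
      omega

lemma segmentationCost_insert (J : ℤ → ℤ → ℝ) (h : Consec N u v) (huw : u < w) (hwv : w < v) :
    segmentationCost J (insert w N) = segmentationCost J N - J u v + J u w + J w v := by
  have hw : ∀ a, ¬ Consec N a w := fun a ha => by
    have := h.le_or_le ha.right_mem
    omega
  have hw' : ∀ b, ¬ Consec N w b := fun b hb => by
    have := h.le_or_le hb.left_mem
    omega
  have hsum : segmentationCost J N =
      ∑ p ∈ (consecPairs N).erase (u, v), J p.1 p.2 + J u v :=
    (Finset.sum_erase_add _ (fun p : ℤ × ℤ => J p.1 p.2)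
      ((mem_consecPairs (p := (u, v))).2 h)).symm
  rw [hsum, segmentationCost, consecPairs_insert h huw hwv, Finset.sum_insert, Finset.sum_insert]
  · ring
  · simp [mem_consecPairs, hw']
  · simp [mem_consecPairs, hw, huw.ne]

lemma segmentationCost_insert_le (hJ : ∀ a, 0 ≤ J a a) (h : Consec N u v) (huw : u ≤ w)
    (hwv : w ≤ v) :
    segmentationCost J (insert w N) ≤ segmentationCost J N - J u v + J u w + J w v := by
  rcases huw.eq_or_lt with rfl | huw
  · rw [Finset.insert_eq_of_mem h.left_mem]
    linarith [hJ u]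
  rcases hwv.eq_or_lt with rfl | hwv
  · rw [Finset.insert_eq_of_mem h.right_mem]
    linarith [hJ w]
  exact (segmentationCost_insert J h huw hwv).le

lemma segmentationCost_erase (J : ℤ → ℤ → ℝ) (h : Consec N u w) (h' : Consec N w v) :
    segmentationCost J (N.erase w) = segmentationCost J N - J u w - J w v + J u v := by
  have hins := segmentationCost_insert J (h.erase h') h.lt h'.lt
  rw [Finset.insert_erase h.right_mem] at hins
  linarith

lemma segmentationCost_neg (J : ℤ → ℤ → ℝ) (N : Finset ℤ) :
    segmentationCost J (-N) = segmentationCost (fun a b => J (-b) (-a)) N := by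
  refine Finset.sum_bij' (fun p _ => (-p.2, -p.1)) (fun p _ => (-p.2, -p.1)) ?_ ?_ ?_ ?_ ?_
  · exact fun p hp => mem_consecPairs.2 (Consec.neg_iff.1 (mem_consecPairs.1 hp))
  · exact fun p hp => mem_consecPairs.2 (mem_consecPairs.1 hp).neg
  all_goals simp

end Cost

/-- `N` is the set of nodes of a segmentation of the times `lo, …, hi - 1` that minimizes the
penalized least-squares cost of the sequence with partial sums `F`. -/
structure IsOptimalSegmentation (F : ℤ → ℝ) (n L q : ℝ) (lo hi : ℤ) (N : Finset ℤ) : Prop where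
  lo_mem : lo ∈ N
  hi_mem : hi ∈ N
  subset_Icc : N ⊆ Finset.Icc lo hi
  cost_le : ∀ M : Finset ℤ, lo ∈ M → hi ∈ M → M ⊆ Finset.Icc lo hi →
    segmentationCost (segCost F n L q) N ≤ segmentationCost (segCost F n L q) M

namespace IsOptimalSegmentation

variable {F : ℤ → ℝ} {n L q : ℝ} {N : Finset ℤ} {lo hi u' u t v l w s : ℤ}

lemma lo_le (O : IsOptimalSegmentation F n L q lo hi N) (ht : t ∈ N) : lo ≤ t :=
  (Finset.mem_Icc.1 (O.subset_Icc ht)).1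

lemma le_hi (O : IsOptimalSegmentation F n L q lo hi N) (ht : t ∈ N) : t ≤ hi :=
  (Finset.mem_Icc.1 (O.subset_Icc ht)).2

lemma reflect (O : IsOptimalSegmentation F n L q lo hi N) :
    IsOptimalSegmentation (reflect F) n L q (-hi) (-lo) (-N) := by
  have hcost : ∀ M : Finset ℤ, segmentationCost (segCost (ChangePoint.reflect F) n L q) M =
      segmentationCost (segCost F n L q) (-M) := fun M => by
    simp only [segmentationCost_neg, funext₂ (segCost_reflect F n L q)]
  refine ⟨by simpa using O.hi_mem, by simpa using O.lo_mem, fun p hp => ?_, fun M hlo hhi hM => ?_⟩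
  · have := O.lo_le (Finset.mem_neg'.1 hp)
    have := O.le_hi (Finset.mem_neg'.1 hp)
    exact Finset.mem_Icc.2 (by omega)
  · rw [hcost, hcost, neg_neg]
    refine O.cost_le (-M) (by simpa using hhi) (by simpa using hlo) fun p hp => ?_
    have := Finset.mem_Icc.1 (hM (Finset.mem_neg'.1 hp))
    exact Finset.mem_Icc.2 (by omega)

lemma exists_next (O : IsOptimalSegmentation F n L q lo hi N) (ht : t ∈ N) (hthi : t < hi) :
    ∃ v, Consec N t v := by
  have hne : {p ∈ N | t < p}.Nonempty := ⟨hi, Finset.mem_filter.2 ⟨O.hi_mem, hthi⟩⟩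
  obtain ⟨hv, htv⟩ := Finset.mem_filter.1 (Finset.min'_mem _ hne)
  refine ⟨_, ht, hv, htv, fun p hp => (le_or_gt p t).imp_right fun htp => ?_⟩
  exact Finset.min'_le _ _ (Finset.mem_filter.2 ⟨hp, htp⟩)

lemma exists_consec_lt_lt (O : IsOptimalSegmentation F n L q lo hi N) (hlot : lo < t)
    (hthi : t < hi) (ht : t ∉ N) : ∃ u v, Consec N u v ∧ u < t ∧ t < v := by
  have hne : {p ∈ N | p < t}.Nonempty := ⟨lo, Finset.mem_filter.2 ⟨O.lo_mem, hlot⟩⟩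
  obtain ⟨hu, hut⟩ := Finset.mem_filter.1 (Finset.max'_mem _ hne)
  obtain ⟨v, huv⟩ := O.exists_next hu (hut.trans hthi)
  refine ⟨_, v, huv, hut, ?_⟩
  by_contra! hvt
  have hvt : v < t := hvt.lt_of_ne fun h => ht (h ▸ huv.right_mem)
  exact (Finset.le_max' _ v (Finset.mem_filter.2 ⟨huv.right_mem, hvt⟩)).not_gt huv.lt

section LocalMoves

lemma cost_le_insert (O : IsOptimalSegmentation F n L q lo hi N) {M : Finset ℤ} (hNM : N ⊆ M)
    (hM : ∀ p ∈ M, p ∈ N ∨ lo ≤ p ∧ p ≤ hi) :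
    segmentationCost (segCost F n L q) N ≤ segmentationCost (segCost F n L q) M :=
  O.cost_le M (hNM O.lo_mem) (hNM O.hi_mem) fun p hp =>
    (hM p hp).elim (fun h => O.subset_Icc h) Finset.mem_Icc.2

lemma segCost_le_of_insert (O : IsOptimalSegmentation F n L q lo hi N) (h : Consec N u v)
    (huw : u < w) (hwv : w < v) :
    segCost F n L q u v ≤ segCost F n L q u w + segCost F n L q w v := by
  have hlo := O.lo_le h.left_mem
  have hhi := O.le_hi h.right_mem
  have hcost := O.cost_le_insert (Finset.subset_insert w N) fun p hp =>
    (Finset.mem_insert.1 hp).symm.imp_right fun hp => by omega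
  rw [segmentationCost_insert _ h huw hwv] at hcost
  linarith

lemma segCost_le_of_insert_three (O : IsOptimalSegmentation F n L q lo hi N) (hLq : 0 ≤ L * q)
    (h : Consec N u v) (hul : u ≤ l) (hlt : l < t) (htw : t < w) (hwv : w ≤ v) :
    segCost F n L q u v ≤
      segCost F n L q u l + segCost F n L q l t + segCost F n L q t w + segCost F n L q w v := by
  have hlo := O.lo_le h.left_mem
  have hhi := O.le_hi h.right_mem
  have hJ : ∀ a, 0 ≤ segCost F n L q a a := fun a => (segCost_self F n L q a).symm ▸ hLq
  have hut := h.insert_left (hul.trans_lt hlt) (htw.trans_le hwv)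
  have htv := h.insert_right (hul.trans_lt hlt) (htw.trans_le hwv)
  have hcost := O.cost_le_insert (M := insert l (insert w (insert t N)))
    (fun p hp => by simp [hp]) fun p hp => by
      simp only [Finset.mem_insert] at hp
      have := hul.trans_lt (hlt.trans (htw.trans_le hwv))
      rcases hp with hp | hp | hp | hp
      · right; omega
      · right; omega
      · right; omega
      · exact Or.inl hp
  have ht := segmentationCost_insert (segCost F n L q) h (hul.trans_lt hlt) (htw.trans_le hwv)
  have hw := segmentationCost_insert_le hJ htv htw.le hwv
  have hl := segmentationCost_insert_le hJ (hut.insert_of_notMem_Ioo (Or.inr htw.le)) hul hlt.le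
  linarith

lemma lo_lt_of_consec (O : IsOptimalSegmentation F n L q lo hi N) (h : Consec N u t) : lo < t :=
  (O.lo_le h.left_mem).trans_lt h.lt

lemma lt_hi_of_consec (O : IsOptimalSegmentation F n L q lo hi N) (h : Consec N t v) : t < hi :=
  h.lt.trans_le (O.le_hi h.right_mem)

lemma segCost_add_le_of_erase (O : IsOptimalSegmentation F n L q lo hi N) (h : Consec N u t)
    (h' : Consec N t v) :
    segCost F n L q u t + segCost F n L q t v ≤ segCost F n L q u v := by
  have hcost := O.cost_le (N.erase t)
    (Finset.mem_erase.2 ⟨(O.lo_lt_of_consec h).ne, O.lo_mem⟩)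
    (Finset.mem_erase.2 ⟨(O.lt_hi_of_consec h').ne', O.hi_mem⟩)
    ((N.erase_subset t).trans O.subset_Icc)
  rw [segmentationCost_erase _ h h'] at hcost
  linarith

lemma segCost_add_le_of_move (O : IsOptimalSegmentation F n L q lo hi N) (h : Consec N u t)
    (h' : Consec N t v) (huw : u < w) (hwv : w < v) :
    segCost F n L q u t + segCost F n L q t v ≤ segCost F n L q u w + segCost F n L q w v := by
  have hlo := O.lo_le h.left_mem
  have hhi := O.le_hi h'.right_mem
  have hcost := O.cost_le (insert w (N.erase t))
    (Finset.mem_insert_of_mem (Finset.mem_erase.2 ⟨(O.lo_lt_of_consec h).ne, O.lo_mem⟩))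
    (Finset.mem_insert_of_mem (Finset.mem_erase.2 ⟨(O.lt_hi_of_consec h').ne', O.hi_mem⟩))
    (Finset.insert_subset (Finset.mem_Icc.2 (by omega)) ((N.erase_subset t).trans O.subset_Icc))
  rw [segmentationCost_insert _ (h.erase h') huw hwv, segmentationCost_erase _ h h'] at hcost
  linarith

lemma segCost_add_le_of_merge (O : IsOptimalSegmentation F n L q lo hi N) (h₁ : Consec N u' u)
    (h₂ : Consec N u t) (h₃ : Consec N t v) (huw : u' < w) (hwv : w < v) :
    segCost F n L q u' u + segCost F n L q u t + segCost F n L q t v ≤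
      segCost F n L q u' w + segCost F n L q w v := by
  have hlo := O.lo_le h₁.left_mem
  have hhi := O.le_hi h₃.right_mem
  have h₃' : Consec (N.erase u) t v := h₃.erase_of_ne h₂.lt.ne' (h₂.lt.trans h₃.lt).ne'
  have hcost := O.cost_le (insert w ((N.erase u).erase t))
    (by simp [O.lo_mem, (O.lo_lt_of_consec h₁).ne, (O.lo_lt_of_consec h₂).ne])
    (by simp [O.hi_mem, (O.lt_hi_of_consec h₂).ne', (O.lt_hi_of_consec h₃).ne'])
    (Finset.insert_subset (Finset.mem_Icc.2 (by omega))
      (((N.erase u).erase_subset t).trans ((N.erase_subset u).trans O.subset_Icc)))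
  rw [segmentationCost_insert _ ((h₁.erase h₂).erase h₃') huw hwv,
    segmentationCost_erase _ (h₁.erase h₂) h₃', segmentationCost_erase _ h₁ h₂] at hcost
  linarith

lemma cusumSq_le_mul_thresholdSq (O : IsOptimalSegmentation F n L q lo hi N) (hn : 0 < n)
    (h : Consec N u v) (huw : u < w) (hwv : w < v) :
    cusumSq F u w v ≤ L * thresholdSq n q u w v := by
  linarith [O.segCost_le_of_insert h huw hwv, segCost_add_sub F L q hn huw hwv]

lemma mul_thresholdSq_le_cusumSq (O : IsOptimalSegmentation F n L q lo hi N) (hn : 0 < n)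
    (h : Consec N u t) (h' : Consec N t v) :
    L * thresholdSq n q u t v ≤ cusumSq F u t v := by
  linarith [O.segCost_add_le_of_erase h h', segCost_add_sub F L q hn h.lt h'.lt]

lemma log_sub_le_log (O : IsOptimalSegmentation F n L q lo hi N) (hn : (hi : ℝ) - lo ≤ n)
    (h : Consec N u v) : Real.log ((v : ℝ) - u) ≤ Real.log n := by
  have hlo : (lo : ℝ) ≤ u := by exact_mod_cast O.lo_le h.left_mem
  have hhi : (v : ℝ) ≤ hi := by exact_mod_cast O.le_hi h.right_mem
  exact Real.log_le_log (sub_cast_pos h.lt) (by linarith)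

lemma mul_sub_le_of_move (O : IsOptimalSegmentation F n L q lo hi N) (hn : 0 < n) (hL : 0 ≤ L)
    (h : Consec N u t) (h' : Consec N t v) (hus : u < s) (hst : s < t) {d : ℝ}
    (hleft : 2 * d * ((t : ℝ) - s) ≤ cusumSq F u s t)
    (hright : cusumSq F s t v ≤ d * ((t : ℝ) - s)) : d * ((s : ℝ) - u) ≤ 2 * L := by
  have hsu := sub_cast_pos hus
  have hts := sub_cast_pos hst
  have hvt := sub_cast_pos h'.lt
  have hmove := O.segCost_add_le_of_move h h' hus (hst.trans h'.lt)
  rw [segCost_eq F L q hn h.lt, segCost_eq F L q hn h'.lt, segCost_eq F L q hn hus,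
    segCost_eq F L q hn (hst.trans h'.lt)] at hmove
  have hlog_right : Real.log ((v : ℝ) - t) ≤ Real.log ((v : ℝ) - s) :=
    Real.log_le_log hvt (by linarith)
  have hlog_left : Real.log ((t : ℝ) - u) - Real.log ((s : ℝ) - u) ≤
      ((t : ℝ) - s) / ((s : ℝ) - u) := by
    rw [← Real.log_div (by linarith) hsu.ne']
    refine (Real.log_le_sub_one_of_pos (div_pos (by linarith) hsu)).trans_eq ?_
    rw [div_sub_one hsu.ne']
    ring
  have hpenalty := mul_le_mul_of_nonneg_left
    (show 2 * (Real.log ((t : ℝ) - u) + Real.log ((v : ℝ) - t) - Real.log ((s : ℝ) - u) -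
      Real.log ((v : ℝ) - s)) ≤ 2 * (((t : ℝ) - s) / ((s : ℝ) - u)) by linarith) hL
  have hgain : d * ((t : ℝ) - s) ≤ L * (2 * (((t : ℝ) - s) / ((s : ℝ) - u))) := by
    rw [cusumSq] at hleft hright
    linarith
  rw [← mul_div_assoc, ← mul_div_assoc, le_div_iff₀ hsu] at hgain
  exact le_of_mul_le_mul_right (by linarith) hts

lemma mul_add_cusumSq_le_of_merge (O : IsOptimalSegmentation F n L q lo hi N) (hn : 0 < n)
    (hlohi : (hi : ℝ) - lo ≤ n) (hL : 0 ≤ L) (h₁ : Consec N u' u) (h₂ : Consec N u t)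
    (h₃ : Consec N t v) (hus : u < s) (hst : s < t) :
    L * q + cusumSq F u s t ≤ cusumSq F u' u s + cusumSq F s t v := by
  have hmerge := O.segCost_add_le_of_merge h₁ h₂ h₃ (h₁.lt.trans hus) (hst.trans h₃.lt)
  rw [segCost_eq F L q hn h₁.lt, segCost_eq F L q hn h₂.lt, segCost_eq F L q hn h₃.lt,
    segCost_eq F L q hn (h₁.lt.trans hus), segCost_eq F L q hn (hst.trans h₃.lt)] at hmerge
  have hlog₁ : Real.log ((u : ℝ) - u') ≤ Real.log ((s : ℝ) - u') :=
    Real.log_le_log (sub_cast_pos h₁.lt) (by linarith [sub_cast_pos hus])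
  have hlog₂ := O.log_sub_le_log hlohi h₂
  have hlog₃ : Real.log ((v : ℝ) - t) ≤ Real.log ((v : ℝ) - s) :=
    Real.log_le_log (sub_cast_pos h₃.lt) (by linarith [sub_cast_pos hst])
  have hpenalty := mul_nonneg hL (show 0 ≤ 2 * ((Real.log ((s : ℝ) - u') -
    Real.log ((u : ℝ) - u')) + (Real.log n - Real.log ((t : ℝ) - u)) +
    (Real.log ((v : ℝ) - s) - Real.log ((v : ℝ) - t))) by linarith)
  rw [cusumSq, cusumSq, cusumSq]
  linarith

end LocalMoves

end IsOptimalSegmentation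

/-- A window of half-width `m` around the change-point `s`, in which the signal takes the value
`μ₁` before `s` and `μ₂` from `s` on, for observations and noise with partial sums `F` and `E` at
the times `lo, …, hi - 1`. The jump is large compared with the penalty, and the fluctuations of the
noise around `s` are small compared with the jump at all distances at least `r`. -/
structure JumpWindow (F E : ℤ → ℝ) (n L q μ₁ μ₂ r : ℝ) (s m lo hi : ℤ) : Prop where
  le_L : 100 ≤ L
  lt_q : 10 < q
  one_le : 1 ≤ m
  lo_le : lo ≤ s - m
  le_hi : s + m ≤ hi
  sub_le_n : (hi : ℝ) - lo ≤ n
  r_pos : 0 < r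
  left : ∀ p, s - m ≤ p → p ≤ s → F p - F s = μ₁ * ((p : ℝ) - s) + (E p - E s)
  right : ∀ p, s ≤ p → p ≤ s + m → F p - F s = μ₂ * ((p : ℝ) - s) + (E p - E s)
  signal : 1000000 * L * (q + 2 * Real.log (n / m)) ≤ (μ₂ - μ₁) ^ 2 * m
  noise : ∀ a b c, s - m ≤ a → a < b → b < c → c ≤ s + m →
    cusumSq E a b c ≤ 4 * thresholdSq n q a b c
  deviation : ∀ p, s - m ≤ p → p ≤ s + m → r ≤ |(p : ℝ) - s| →
    |E p - E s| ≤ 1 / 16 * |μ₂ - μ₁| * |(p : ℝ) - s|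

namespace JumpWindow

variable {F E : ℤ → ℝ} {n L q μ₁ μ₂ r : ℝ} {s m lo hi u' u t t' v w a b c : ℤ} {N : Finset ℤ}

lemma reflect (W : JumpWindow F E n L q μ₁ μ₂ r s m lo hi) :
    JumpWindow (reflect F) (reflect E) n L q μ₂ μ₁ r (-s) m (-hi) (-lo) where
  le_L := W.le_L
  lt_q := W.lt_q
  one_le := W.one_le
  lo_le := by have := W.le_hi; omega
  le_hi := by have := W.lo_le; omega
  sub_le_n := by push_cast; linarith [W.sub_le_n]
  r_pos := W.r_pos
  signal := by simpa only [sub_sq_comm μ₁] using W.signal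
  left p hp hps := by
    have := W.right (-p) (by omega) (by omega)
    simp only [ChangePoint.reflect, neg_neg]
    push_cast at this ⊢
    linarith
  right p hp hps := by
    have := W.left (-p) (by omega) (by omega)
    simp only [ChangePoint.reflect, neg_neg]
    push_cast at this ⊢
    linarith
  noise a b c ha hab hbc hc := by
    rw [cusumSq_reflect, ← thresholdSq_neg]
    exact W.noise _ _ _ (by omega) (by omega) (by omega) (by omega)
  deviation p hp hps hr := by
    have hdist : |(p : ℝ) - ((-s : ℤ) : ℝ)| = |((-p : ℤ) : ℝ) - s| := by
      rw [← abs_neg]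
      push_cast
      congr 1
      ring
    rw [hdist] at hr ⊢
    have hE : -E (-p) - -E s = -(E (-p) - E s) := by ring
    simpa only [ChangePoint.reflect, neg_neg, abs_sub_comm μ₁, hE, abs_neg] using
      W.deviation (-p) (by omega) (by omega) hr

lemma m_pos (W : JumpWindow F E n L q μ₁ μ₂ r s m lo hi) : (0 : ℝ) < m := by
  exact_mod_cast W.one_le

lemma m_le_n (W : JumpWindow F E n L q μ₁ μ₂ r s m lo hi) : (m : ℝ) ≤ n := by
  have hlo : (lo : ℝ) ≤ (s : ℝ) - m := by exact_mod_cast W.lo_le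
  have hhi : (s : ℝ) + m ≤ hi := by exact_mod_cast W.le_hi
  linarith [W.sub_le_n, W.m_pos]

lemma n_pos (W : JumpWindow F E n L q μ₁ μ₂ r s m lo hi) : 0 < n :=
  W.m_pos.trans_le W.m_le_n

lemma log_div_eq (W : JumpWindow F E n L q μ₁ μ₂ r s m lo hi) :
    Real.log (n / m) = Real.log n - Real.log m :=
  Real.log_div W.n_pos.ne' W.m_pos.ne'

lemma log_div_nonneg (W : JumpWindow F E n L q μ₁ μ₂ r s m lo hi) : 0 ≤ Real.log (n / m) :=
  Real.log_nonneg ((one_le_div W.m_pos).2 W.m_le_n)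

lemma sq_sub_pos (W : JumpWindow F E n L q μ₁ μ₂ r s m lo hi) : 0 < (μ₂ - μ₁) ^ 2 := by
  have hL : 0 < L := by linarith [W.le_L]
  have hq : 0 < q + 2 * Real.log (n / m) := by linarith [W.lt_q, W.log_div_nonneg]
  have hpos : 0 < (μ₂ - μ₁) ^ 2 * m := lt_of_lt_of_le (by positivity) W.signal
  exact pos_of_mul_pos_left hpos W.m_pos.le

section Averages

lemma avg_right (W : JumpWindow F E n L q μ₁ μ₂ r s m lo hi) (ha : s ≤ a) (hab : a < b)
    (hb : b ≤ s + m) : avg F a b = μ₂ + avg E a b := by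
  have hFa := W.right a ha (by omega)
  have hFb := W.right b (by omega) hb
  rw [avg, avg, show F b - F a = μ₂ * ((b : ℝ) - a) + (E b - E a) by linarith, add_div,
    mul_div_cancel_right₀ _ (sub_cast_pos hab).ne']

lemma avg_left (W : JumpWindow F E n L q μ₁ μ₂ r s m lo hi) (ha : s - m ≤ a) (hab : a < b)
    (hb : b ≤ s) : avg F a b = μ₁ + avg E a b := by
  simpa only [avg_reflect, neg_neg] using
    W.reflect.avg_right (a := -b) (b := -a) (by omega) (by omega) (by omega)

lemma cusumSq_eq_noise (W : JumpWindow F E n L q μ₁ μ₂ r s m lo hi) (ha : s ≤ a) (hab : a < b)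
    (hbc : b < c) (hc : c ≤ s + m) : cusumSq F a b c = cusumSq E a b c := by
  rw [cusumSq_eq F hab hbc, cusumSq_eq E hab hbc, W.avg_right ha hab (by omega),
    W.avg_right (by omega) hbc hc, add_sub_add_left_eq_sub]

lemma abs_avg_noise_right_le (W : JumpWindow F E n L q μ₁ μ₂ r s m lo hi) (hsb : s < b)
    (hr : r ≤ (b : ℝ) - s) (hb : b ≤ s + m) : |avg E s b| ≤ 1 / 16 * |μ₂ - μ₁| := by
  have hsb₀ := sub_cast_pos hsb
  rw [avg, abs_div, div_le_iff₀ (abs_pos.2 hsb₀.ne')]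
  exact W.deviation b (by linarith [W.one_le]) hb (by rwa [abs_of_pos hsb₀])

lemma abs_avg_noise_le (W : JumpWindow F E n L q μ₁ μ₂ r s m lo hi) (hr : r ≤ (a : ℝ) - s)
    (hab : 3 * (a - s) ≤ b - s) (hb : b ≤ s + m) : |avg E a b| ≤ 1 / 8 * |μ₂ - μ₁| := by
  have has : s < a := by
    have : (s : ℝ) < a := by linarith [W.r_pos]
    exact_mod_cast this
  have has₀ := sub_cast_pos has
  have hba₀ := sub_cast_pos (show a < b by omega)
  have hab₀ : 3 * ((a : ℝ) - s) ≤ (b : ℝ) - s := by exact_mod_cast hab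
  have hdev_a := W.deviation a (by omega) (by omega) (by rwa [abs_of_pos has₀])
  have hdev_b := W.deviation b (by omega) hb (by rw [abs_of_pos (by linarith)]; linarith)
  rw [abs_of_pos has₀] at hdev_a
  rw [abs_of_pos (show (0 : ℝ) < (b : ℝ) - s by linarith)] at hdev_b
  rw [avg, abs_div, abs_of_pos hba₀, div_le_iff₀ hba₀]
  have htri : |E b - E a| ≤ |E b - E s| + |E a - E s| := by
    rw [abs_sub_comm (E a)]
    exact abs_sub_le _ _ _
  have hweighted := mul_le_mul_of_nonneg_left hab₀ (abs_nonneg (μ₂ - μ₁))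
  linarith

lemma abs_avg_right_sub_le (W : JumpWindow F E n L q μ₁ μ₂ r s m lo hi) (hsb : s < b)
    (hr : r ≤ (b : ℝ) - s) (hb : b ≤ s + m) : |avg F s b - μ₂| ≤ 1 / 16 * |μ₂ - μ₁| := by
  rw [W.avg_right le_rfl hsb hb, add_sub_cancel_left]
  exact W.abs_avg_noise_right_le hsb hr hb

lemma abs_avg_left_sub_le (W : JumpWindow F E n L q μ₁ μ₂ r s m lo hi) (has : a < s)
    (hr : r ≤ (s : ℝ) - a) (ha : s - m ≤ a) : |avg F a s - μ₁| ≤ 1 / 16 * |μ₂ - μ₁| := by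
  have h := W.reflect.abs_avg_right_sub_le (b := -a) (by omega) (by push_cast; linarith) (by omega)
  rwa [avg_reflect, neg_neg, neg_neg, abs_sub_comm μ₁] at h

lemma abs_avg_sub_left_le (W : JumpWindow F E n L q μ₁ μ₂ r s m lo hi) (haw : s - m ≤ w)
    (hws : w < s) (hst : s < t) (ht : t ≤ s + m) (hr : r ≤ (t : ℝ) - s)
    (hwt : 32 * (t - s) ≤ t - w) : |avg F w t - μ₁| ≤ 3 / 32 * |μ₂ - μ₁| := by
  have hws₀ := sub_cast_pos hws
  have hst₀ := sub_cast_pos hst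
  have hwt₀ := sub_cast_pos (hws.trans hst)
  have hwt' : 32 * ((t : ℝ) - s) ≤ (t : ℝ) - w := by exact_mod_cast hwt
  have hdev_w := W.deviation w haw (by omega)
    (by rw [abs_sub_comm, abs_of_pos hws₀]; linarith)
  have hdev_t := W.deviation t (by omega) ht (by rwa [abs_of_pos hst₀])
  rw [abs_sub_comm (w : ℝ), abs_of_pos hws₀] at hdev_w
  rw [abs_of_pos hst₀] at hdev_t
  have havg : avg F w t - μ₁ =
      ((μ₂ - μ₁) * ((t : ℝ) - s) + (E t - E s) - (E w - E s)) / ((t : ℝ) - w) := by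
    rw [avg, eq_div_iff hwt₀.ne', sub_mul, div_mul_cancel₀ _ hwt₀.ne']
    linarith [W.left w haw hws.le, W.right t hst.le ht]
  rw [havg, abs_div, abs_of_pos hwt₀, div_le_iff₀ hwt₀]
  have htri := abs_sub ((μ₂ - μ₁) * ((t : ℝ) - s) + (E t - E s)) (E w - E s)
  have htri' := abs_add_le ((μ₂ - μ₁) * ((t : ℝ) - s)) (E t - E s)
  rw [abs_mul, abs_of_pos hst₀] at htri'
  have hweighted := mul_le_mul_of_nonneg_left hwt' (abs_nonneg (μ₂ - μ₁))
  linarith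

end Averages

section LongSegments

lemma thresholdSq_le_two_mul (W : JumpWindow F E n L q μ₁ μ₂ r s m lo hi)
    (htw : m ≤ 4 * (w - t)) (hwv : w - t ≤ v - w) :
    thresholdSq n q t w v ≤ 2 * (q + 2 * Real.log (n / m)) := by
  have hm := W.one_le
  have htw₀ : (m : ℝ) ≤ 4 * ((w : ℝ) - t) := by exact_mod_cast htw
  have hwv₀ : (w : ℝ) - t ≤ (v : ℝ) - w := by exact_mod_cast hwv
  have hm₀ : (0 : ℝ) < m / 4 := by linarith [W.m_pos]
  have hψ := thresholdSq_le n q (show t < w by omega) (show w < v by omega) hm₀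
    (by linarith) (by linarith)
  have hlog := log_le_of_le_two_pow_mul 2 W.m_pos hm₀ (by linarith)
  push_cast at hlog
  linarith [W.log_div_eq, W.lt_q, log_two_lt, W.log_div_nonneg]

/-- By optimality, splitting a segment does not pay for the penalty, which the signal dominates. -/
lemma abs_avg_sub_avg_le (W : JumpWindow F E n L q μ₁ μ₂ r s m lo hi)
    (O : IsOptimalSegmentation F n L q lo hi N) (h : Consec N t v) (htw : m ≤ 4 * (w - t))
    (hwv : w - t ≤ v - w) : |avg F t v - avg F t w| ≤ 1 / 16 * |μ₂ - μ₁| := by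
  have hm := W.one_le
  have htw_lt : t < w := by omega
  have hwv_lt : w < v := by omega
  have htw₀ : (m : ℝ) ≤ 4 * ((w : ℝ) - t) := by exact_mod_cast htw
  have hψ := mul_le_mul_of_nonneg_left (W.thresholdSq_le_two_mul htw hwv)
    (show 0 ≤ L by linarith [W.le_L])
  have hcusum := (sq_avg_sub_left_le F htw_lt hwv_lt).trans
    (O.cusumSq_le_mul_thresholdSq W.n_pos h htw_lt hwv_lt)
  have hsq : (avg F t v - avg F t w) ^ 2 * m ≤ (1 / 16 * |μ₂ - μ₁|) ^ 2 * m := by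
    rw [mul_pow, sq_abs]
    have := mul_le_mul_of_nonneg_left htw₀ (sq_nonneg (avg F t v - avg F t w))
    linarith [W.signal, mul_nonneg (sq_nonneg (μ₂ - μ₁)) W.m_pos.le]
  exact abs_le_of_sq_le_sq (le_of_mul_le_mul_right hsq W.m_pos) (by positivity)

lemma abs_avg_sub_avg_le' (W : JumpWindow F E n L q μ₁ μ₂ r s m lo hi)
    (O : IsOptimalSegmentation F n L q lo hi N) (h : Consec N u t) (hwt : m ≤ 4 * (t - w))
    (huw : t - w ≤ w - u) : |avg F u t - avg F w t| ≤ 1 / 16 * |μ₂ - μ₁| := by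
  have h := W.reflect.abs_avg_sub_avg_le O.reflect h.neg (w := -w) (by omega) (by omega)
  simpa only [avg_reflect, neg_neg, abs_sub_comm μ₁] using h

lemma abs_avg_sub_le (W : JumpWindow F E n L q μ₁ μ₂ r s m lo hi)
    (O : IsOptimalSegmentation F n L q lo hi N) (h : Consec N t v) (hr : r ≤ (t : ℝ) - s)
    (ht : 256 * (t - s) < m) (hv : m ≤ 64 * (v - s)) :
    |avg F t v - μ₂| ≤ 3 / 16 * |μ₂ - μ₁| := by
  have hst : s < t := by
    have : (s : ℝ) < t := by linarith [W.r_pos]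
    exact_mod_cast this
  have hD := abs_nonneg (μ₂ - μ₁)
  rcases le_or_gt v (s + m) with hvm | hvm
  · rw [W.avg_right hst.le h.lt hvm, add_sub_cancel_left]
    linarith [W.abs_avg_noise_le hr (b := v) (by omega) hvm]
  · obtain ⟨w, hw⟩ : ∃ w, w = s + m / 2 := ⟨_, rfl⟩
    have hlong := W.abs_avg_sub_avg_le O h (w := w) (by omega) (by omega)
    have hnoise := W.abs_avg_noise_le hr (b := w) (by omega) (by omega)
    rw [W.avg_right (b := w) hst.le (by omega) (by omega)] at hlong
    calc |avg F t v - μ₂| = |(avg F t v - (μ₂ + avg E t w)) + avg E t w| := by ring_nf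
      _ ≤ |avg F t v - (μ₂ + avg E t w)| + |avg E t w| := abs_add_le _ _
      _ ≤ 3 / 16 * |μ₂ - μ₁| := by linarith

end LongSegments

section TwoNodes

lemma add_lt_of_consec_of_consec (W : JumpWindow F E n L q μ₁ μ₂ r s m lo hi)
    (O : IsOptimalSegmentation F n L q lo hi N) (hst : s ≤ t) (h : Consec N t t')
    (h' : Consec N t' v) : s + m < v := by
  by_contra! hv
  have hlog := O.log_sub_le_log W.sub_le_n h
  have hψ := (le_thresholdSq n q h.lt h'.lt).trans' (show q ≤ _ by linarith)
  have hpen := O.mul_thresholdSq_le_cusumSq W.n_pos h h'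
  rw [W.cusumSq_eq_noise hst h.lt h'.lt hv] at hpen
  have hnoise := W.noise t t' v (by linarith [W.one_le]) h.lt h'.lt hv
  have hpos := mul_pos (show 0 < L - 4 by linarith [W.le_L])
    (show 0 < thresholdSq n q t t' v by linarith [W.lt_q])
  linarith

/-- The segment `[t', w)` is at least `16` times as long as `[t, t')`. This gives the factor `16`
and makes the threshold at `(t', w, v)` at most the one at `(t, t', v)`. -/
lemma sq_avg_sub_avg_mul_le_of_consec (W : JumpWindow F E n L q μ₁ μ₂ r s m lo hi)
    (O : IsOptimalSegmentation F n L q lo hi N) (hst : s ≤ t) (htt : t < t') (h' : Consec N t' v)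
    (ht : 64 * (t' - s) < m) (hv : s + m < v) (hw : w = s + m / 2) :
    (avg F t' v - avg F t' w) ^ 2 * ((t' : ℝ) - t) ≤ L * thresholdSq n q t t' v / 16 := by
  have htw : t' < w := by omega
  have hwv : w < v := by omega
  have htt₀ := sub_cast_pos htt
  have hlong : 16 * ((t' : ℝ) - t) ≤ (w : ℝ) - t' := by
    exact_mod_cast show 16 * (t' - t) ≤ w - t' by omega
  have hwv₀ : (w : ℝ) - t' ≤ (v : ℝ) - w := by
    exact_mod_cast show w - t' ≤ v - w by omega
  have hψ : thresholdSq n q t' w v ≤ thresholdSq n q t t' v := by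
    have := thresholdSq_le n q htw hwv (d := 2 * ((t' : ℝ) - t)) (by positivity)
      (by linarith) (by linarith)
    rw [Real.log_mul two_ne_zero htt₀.ne'] at this
    linarith [le_thresholdSq n q htt h'.lt]
  have hcusum := (sq_avg_sub_left_le F htw hwv).trans
    (O.cusumSq_le_mul_thresholdSq W.n_pos h' htw hwv)
  have hL := mul_le_mul_of_nonneg_left hψ (show 0 ≤ L by linarith [W.le_L])
  have hscale := mul_le_mul_of_nonneg_left hlong (sq_nonneg (avg F t' v - avg F t' w))
  linarith

lemma sq_avg_sub_avg_mul_le_of_noise (W : JumpWindow F E n L q μ₁ μ₂ r s m lo hi) (hst : s ≤ t)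
    (htt : t < t') (hwm : w ≤ s + m) (htw : t' - t ≤ w - t') (htv : t' < v)
    (hn : Real.log ((t' : ℝ) - t) ≤ Real.log n) :
    (avg F t' w - avg F t t') ^ 2 * ((t' : ℝ) - t) ≤ 16 * thresholdSq n q t t' v := by
  have htw₀ : (t' : ℝ) - t ≤ (w : ℝ) - t' := by exact_mod_cast htw
  have hnoise := W.noise t t' w (by linarith [W.one_le]) htt (by omega) hwm
  rw [← W.cusumSq_eq_noise hst htt (by omega) hwm] at hnoise
  have hsq := sq_avg_sub_avg_mul_le F htt (show t' < w by omega) le_rfl htw₀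
  have hψ := thresholdSq_le n q htt (show t' < w by omega) (sub_cast_pos htt) le_rfl htw₀
  linarith [le_thresholdSq n q htt htv, W.lt_q, log_two_lt]

lemma le_of_consec_of_consec (W : JumpWindow F E n L q μ₁ μ₂ r s m lo hi)
    (O : IsOptimalSegmentation F n L q lo hi N) (hst : s ≤ t) (h : Consec N t t')
    (h' : Consec N t' v) : m ≤ 64 * (t' - s) := by
  by_contra! ht
  have hv := W.add_lt_of_consec_of_consec O hst h h'
  obtain ⟨w, hw⟩ : ∃ w, w = s + m / 2 := ⟨_, rfl⟩
  have htt := h.lt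
  have hlog := O.log_sub_le_log W.sub_le_n h
  have hψ := (le_thresholdSq n q h.lt h'.lt).trans' (show q ≤ _ by linarith)
  have houter := W.sq_avg_sub_avg_mul_le_of_consec O hst h.lt h' ht hv hw
  have hinner := W.sq_avg_sub_avg_mul_le_of_noise (w := w) hst h.lt (by omega) (by omega) h'.lt
    hlog
  have hpen := (O.mul_thresholdSq_le_cusumSq W.n_pos h h').trans (cusumSq_le_left F h.lt h'.lt)
  have hsplit : (avg F t' v - avg F t t') ^ 2 ≤
      2 * (avg F t' v - avg F t' w) ^ 2 + 2 * (avg F t' w - avg F t t') ^ 2 := by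
    linarith [sq_nonneg (avg F t' v - avg F t' w - (avg F t' w - avg F t t'))]
  have hsplit_mul := mul_le_mul_of_nonneg_right hsplit (sub_cast_pos h.lt).le
  have hpos := mul_pos (show 0 < L - 40 by linarith [W.le_L])
    (show 0 < thresholdSq n q t t' v by linarith [W.lt_q])
  linarith [W.lt_q]

lemma exists_consec_right (W : JumpWindow F E n L q μ₁ μ₂ r s m lo hi)
    (O : IsOptimalSegmentation F n L q lo hi N) (ht : t ∈ N) (hst : s ≤ t) (htm : t < s + m) :
    ∃ v, Consec N t v ∧ m ≤ 64 * (v - s) := by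
  have hhi := W.le_hi
  obtain ⟨v, hv⟩ := O.exists_next ht (by omega)
  refine ⟨v, hv, ?_⟩
  rcases le_or_gt (s + m) v with hvm | hvm
  · linarith [W.one_le]
  · obtain ⟨v', hv'⟩ := O.exists_next hv.right_mem (by omega)
    exact W.le_of_consec_of_consec O hst hv hv'

lemma exists_consec_left (W : JumpWindow F E n L q μ₁ μ₂ r s m lo hi)
    (O : IsOptimalSegmentation F n L q lo hi N) (hu : u ∈ N) (hus : u ≤ s) (hum : s - m < u) :
    ∃ u', Consec N u' u ∧ m ≤ 64 * (s - u') := by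
  obtain ⟨v, hv, hvm⟩ := W.reflect.exists_consec_right O.reflect (t := -u) (by simpa using hu)
    (by omega) (by omega)
  exact ⟨-v, by simpa using hv.neg, by omega⟩

end TwoNodes

section NearNode

lemma lt_cusumSq_of_jump (W : JumpWindow F E n L q μ₁ μ₂ r s m lo hi) (ha : s - m ≤ a)
    (has : m ≤ 256 * (s - a)) (hcs : m ≤ 256 * (c - s)) (hc : c ≤ s + m) :
    12 * (L * (q + 2 * Real.log (n / m))) < cusumSq F a s c := by
  have hm := W.one_le
  have has_lt : a < s := by omega
  have hcs_lt : s < c := by omega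
  have hm₀ : (0 : ℝ) < m / 256 := by linarith [W.m_pos]
  have has₀ : (m : ℝ) ≤ 256 * ((s : ℝ) - a) := by exact_mod_cast has
  have hcs₀ : (m : ℝ) ≤ 256 * ((c : ℝ) - s) := by exact_mod_cast hcs
  have hsqF := sq_avg_sub_avg_mul_le F has_lt hcs_lt (d := m / 256) (by linarith) (by linarith)
  have hsqE := sq_avg_sub_avg_mul_le E has_lt hcs_lt (d := m / 256) (by linarith) (by linarith)
  have hnoise : cusumSq E a s c ≤ 12 * (q + 2 * Real.log (n / m)) := by
    have hψ := thresholdSq_le n q has_lt hcs_lt hm₀ (by linarith) (by linarith)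
    have hlog := log_le_of_le_two_pow_mul 8 W.m_pos hm₀ (by linarith)
    push_cast at hlog
    linarith [W.noise a s c ha has_lt hcs_lt hc, W.log_div_eq, W.log_div_nonneg, W.lt_q,
      log_two_lt]
  rw [W.avg_left ha has_lt le_rfl, W.avg_right le_rfl hcs_lt hc] at hsqF
  have hjump : (μ₂ - μ₁) ^ 2 ≤ 2 * (μ₂ + avg E s c - (μ₁ + avg E a s)) ^ 2 +
      2 * (avg E s c - avg E a s) ^ 2 := by
    linarith [sq_nonneg (μ₂ + avg E s c - (μ₁ + avg E a s) + (avg E s c - avg E a s))]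
  have hjump_mul := mul_le_mul_of_nonneg_right hjump hm₀.le
  have hpos : 0 < q + 2 * Real.log (n / m) := by linarith [W.lt_q, W.log_div_nonneg]
  have hL := mul_le_mul_of_nonneg_right W.le_L hpos.le
  linarith [W.signal]

lemma segCost_le (W : JumpWindow F E n L q μ₁ μ₂ r s m lo hi) (h : a = b ∨ m ≤ 256 * (b - a)) :
    segCost F n L q a b ≤ -explained F a b + L * (q + 2 * (5.6 + Real.log (n / m))) := by
  have hL : 0 ≤ L := by linarith [W.le_L]
  rcases h with rfl | h
  · rw [segCost_self, explained, sub_self, zero_pow two_ne_zero, zero_div, neg_zero, zero_add]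
    exact mul_le_mul_of_nonneg_left (by linarith [W.log_div_nonneg]) hL
  · have hm := W.one_le
    have hab : a < b := by omega
    have h₀ : (m : ℝ) ≤ 256 * ((b : ℝ) - a) := by exact_mod_cast h
    have hlog := log_le_of_le_two_pow_mul 8 W.m_pos (sub_cast_pos hab) (by linarith)
    push_cast at hlog
    rw [segCost_eq F L q W.n_pos hab]
    gcongr
    linarith [W.log_div_eq]

lemma cusumSq_le_of_cut (W : JumpWindow F E n L q μ₁ μ₂ r s m lo hi)
    (O : IsOptimalSegmentation F n L q lo hi N) (h : Consec N u v) (hua : u ≤ a)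
    (ha : u = a ∨ m ≤ 256 * (a - u)) (has : m ≤ 256 * (s - a)) (hcs : m ≤ 256 * (c - s))
    (hcv : c ≤ v) (hc : c = v ∨ m ≤ 256 * (v - c)) :
    cusumSq F a s c ≤ 12 * (L * (q + 2 * Real.log (n / m))) := by
  have hm := W.one_le
  have hL : 0 ≤ L := by linarith [W.le_L]
  have hins := O.segCost_le_of_insert_three (mul_nonneg hL (by linarith [W.lt_q])) h hua
    (show a < s by omega) (show s < c by omega) hcv
  have huv : -explained F u v + L * q ≤ segCost F n L q u v := by
    rw [segCost_eq F L q W.n_pos h.lt]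
    have := mul_nonneg hL (sub_nonneg.2 (O.log_sub_le_log W.sub_le_n h))
    linarith
  have hex := explained_le_add F hua (show a ≤ v by omega)
  have hex' := explained_le_add F (show a ≤ c by omega) hcv
  have hq := mul_nonneg hL (show 0 ≤ 9 * q + 16 * Real.log (n / m) - 44.8 by
    linarith [W.lt_q, W.log_div_nonneg])
  rw [cusumSq]
  linarith [W.segCost_le ha, W.segCost_le (Or.inr has), W.segCost_le (Or.inr hcs),
    W.segCost_le hc]

lemma exists_cut (hm : 1 ≤ m) (hv : m ≤ 256 * (v - s)) :
    ∃ c, c ≤ v ∧ m ≤ 256 * (c - s) ∧ c ≤ s + m ∧ (c = v ∨ m ≤ 256 * (v - c)) := by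
  rcases le_or_gt (v - s) m with h | h
  · exact ⟨v, by omega, by omega, by omega, by omega⟩
  · exact ⟨s + (m + 1) / 2, by omega, by omega, by omega, by omega⟩

lemma lt_or_lt_of_consec (W : JumpWindow F E n L q μ₁ μ₂ r s m lo hi)
    (O : IsOptimalSegmentation F n L q lo hi N) (h : Consec N u v) :
    256 * (s - u) < m ∨ 256 * (v - s) < m := by
  by_contra! hfar
  obtain ⟨c, hcv, hcs, hcm, hc⟩ := exists_cut W.one_le hfar.2
  obtain ⟨a, hau, has, ham, ha⟩ := exists_cut (v := -u) (s := -s) W.one_le (by omega)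
  refine (W.lt_cusumSq_of_jump (a := -a) (by omega) (by omega) hcs hcm).not_ge ?_
  exact W.cusumSq_le_of_cut O h (by omega) (by omega) (by omega) hcs hcv hc

end NearNode

section Gain

lemma sq_jump_le {x y : ℝ} (hx : |x - μ₂| ≤ 1 / 16 * |μ₂ - μ₁|)
    (hy : |y - μ₁| ≤ 3 / 16 * |μ₂ - μ₁|) : 9 / 16 * (μ₂ - μ₁) ^ 2 ≤ (x - y) ^ 2 := by
  have htri : |μ₂ - μ₁| ≤ |x - y| + |x - μ₂| + |y - μ₁| := by
    rw [show μ₂ - μ₁ = (x - y) - (x - μ₂) + (y - μ₁) by ring]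
    exact (abs_add_le _ _).trans (add_le_add_left (abs_sub _ _) _)
  have hsq := pow_le_pow_left₀ (by positivity) (show 3 / 4 * |μ₂ - μ₁| ≤ |x - y| by linarith) 2
  rw [sq_abs, mul_pow, sq_abs] at hsq
  linarith

lemma abs_avg_sub_le_of_lt (W : JumpWindow F E n L q μ₁ μ₂ r s m lo hi)
    (O : IsOptimalSegmentation F n L q lo hi N) (h : Consec N u t) (hu : u < s - m) (hst : s < t)
    (ht : 256 * (t - s) < m) (hr : r ≤ (t : ℝ) - s) :
    |avg F u t - μ₁| ≤ 3 / 16 * |μ₂ - μ₁| := by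
  obtain ⟨w, hw⟩ : ∃ w, w = s - m / 4 := ⟨_, rfl⟩
  have hlong := W.abs_avg_sub_avg_le' O h (w := w) (by omega) (by omega)
  have hshort := W.abs_avg_sub_left_le (w := w) (by omega) (by omega) hst (by omega) hr (by omega)
  linarith [abs_sub_le (avg F u t) (avg F w t) μ₁, abs_nonneg (μ₂ - μ₁)]

lemma le_cusumSq (W : JumpWindow F E n L q μ₁ μ₂ r s m lo hi)
    (O : IsOptimalSegmentation F n L q lo hi N) (h : Consec N u t) (hus : u < s) (hst : s < t)
    (ht : 256 * (t - s) < m) (hle : t - s ≤ s - u) (hr : r ≤ (t : ℝ) - s) :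
    2 * ((μ₂ - μ₁) ^ 2 / 16) * ((t : ℝ) - s) ≤ cusumSq F u s t := by
  have hst₀ := sub_cast_pos hst
  have hle₀ : (t : ℝ) - s ≤ (s : ℝ) - u := by exact_mod_cast hle
  have hright := W.abs_avg_right_sub_le hst hr (by omega)
  have hpos := mul_nonneg (sq_nonneg (μ₂ - μ₁)) hst₀.le
  rcases le_or_gt (s - m) u with hum | hum
  · have hleft := W.abs_avg_left_sub_le hus (by linarith) hum
    have hjump := mul_le_mul_of_nonneg_right
      (sq_jump_le hright (hleft.trans (by linarith [abs_nonneg (μ₂ - μ₁)]))) hst₀.le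
    linarith [sq_avg_sub_avg_mul_le F hus hst hle₀ le_rfl]
  · have hjump := mul_le_mul_of_nonneg_right
      (sq_jump_le hright (W.abs_avg_sub_le_of_lt O h hum hst ht hr)) hst₀.le
    rw [sub_sq_comm] at hjump
    linarith [sq_avg_sub_right_le F hus hst]

lemma sq_sub_le_of_abs_sub_le {x y μ D : ℝ} (hx : |x - μ| ≤ 1 / 16 * |D|)
    (hy : |y - μ| ≤ 3 / 16 * |D|) : (y - x) ^ 2 ≤ D ^ 2 / 16 := by
  have habs : |y - x| ≤ |D / 4| := by
    rw [abs_div, abs_of_pos (show (0 : ℝ) < 4 by norm_num)]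
    have := abs_sub_le y μ x
    rw [abs_sub_comm μ x] at this
    linarith
  linarith [sq_le_sq.2 habs]

lemma cusumSq_le_right (W : JumpWindow F E n L q μ₁ μ₂ r s m lo hi)
    (O : IsOptimalSegmentation F n L q lo hi N) (h : Consec N t v) (hr : r ≤ (t : ℝ) - s)
    (ht : 256 * (t - s) < m) (hv : m ≤ 64 * (v - s)) :
    cusumSq F s t v ≤ (μ₂ - μ₁) ^ 2 / 16 * ((t : ℝ) - s) := by
  have hst₀ : (0 : ℝ) < (t : ℝ) - s := W.r_pos.trans_le hr
  have hst : s < t := by exact_mod_cast sub_pos.1 hst₀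
  refine (cusumSq_le_left F hst h.lt).trans (mul_le_mul_of_nonneg_right ?_ hst₀.le)
  exact sq_sub_le_of_abs_sub_le (W.abs_avg_right_sub_le hst hr (by omega))
    (W.abs_avg_sub_le O h hr ht hv)

lemma cusumSq_le_left (W : JumpWindow F E n L q μ₁ μ₂ r s m lo hi)
    (O : IsOptimalSegmentation F n L q lo hi N) (h : Consec N u' u) (hr : r ≤ (s : ℝ) - u)
    (hu : 256 * (s - u) < m) (hu' : m ≤ 64 * (s - u')) :
    cusumSq F u' u s ≤ (μ₂ - μ₁) ^ 2 / 16 * ((s : ℝ) - u) := by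
  have h := W.reflect.cusumSq_le_right O.reflect h.neg (by push_cast; linarith) (by omega)
    (by omega)
  simpa only [cusumSq_reflect, neg_neg, sub_sq_comm μ₁, Int.cast_neg, neg_sub_neg] using h

end Gain

section Localization

lemma sub_lt_of_consec (W : JumpWindow F E n L q μ₁ μ₂ r s m lo hi)
    (O : IsOptimalSegmentation F n L q lo hi N) (h : Consec N u t) (hus : u < s) (hst : s < t)
    (ht : 256 * (t - s) < m) (hle : t - s ≤ s - u) : (t : ℝ) - s < r := by
  by_contra! hr
  have hle₀ : (t : ℝ) - s ≤ (s : ℝ) - u := by exact_mod_cast hle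
  have hL := W.le_L
  obtain ⟨v, htv, hv⟩ := W.exists_consec_right O h.right_mem hst.le (by omega)
  have hgain := W.le_cusumSq O h hus hst ht hle hr
  have hright := W.cusumSq_le_right O htv hr ht hv
  have hmove := O.mul_sub_le_of_move W.n_pos (by linarith) h htv hus hst hgain hright
  have hu : 256 * (s - u) < m := by
    have hlt : (μ₂ - μ₁) ^ 2 * (256 * ((s : ℝ) - u)) < (μ₂ - μ₁) ^ 2 * m := by
      have := mul_lt_mul_of_pos_left (show 10 < q + 2 * Real.log (n / m) by
        linarith [W.lt_q, W.log_div_nonneg]) (show 0 < L by linarith)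
      linarith [W.signal]
    exact_mod_cast lt_of_mul_lt_mul_left hlt W.sq_sub_pos.le
  obtain ⟨u', huu, hu'⟩ := W.exists_consec_left O h.left_mem hus.le (by omega)
  have hleft := W.cusumSq_le_left O huu (by linarith) hu hu'
  have hmerge := O.mul_add_cusumSq_le_of_merge W.n_pos W.sub_le_n (by linarith) huu h htv hus hst
  have hq := mul_lt_mul_of_pos_left W.lt_q (show 0 < L by linarith)
  linarith [cusumSq_nonneg F hus hst]

theorem exists_mem_abs_sub_lt (W : JumpWindow F E n L q μ₁ μ₂ r s m lo hi)
    (O : IsOptimalSegmentation F n L q lo hi N) : ∃ p ∈ N, |(p : ℝ) - s| < r ∧ |p - s| < m := by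
  have hm := W.one_le
  have hlo := W.lo_le
  have hhi := W.le_hi
  by_cases hs : s ∈ N
  · exact ⟨s, hs, by simpa using W.r_pos, by rw [sub_self, abs_zero]; omega⟩
  obtain ⟨u, t, h, hus, hst⟩ := O.exists_consec_lt_lt (by omega) (by omega) hs
  have hnear := W.lt_or_lt_of_consec O h
  rcases le_total (t - s) (s - u) with hle | hle
  · refine ⟨t, h.right_mem, ?_, by rw [abs_lt]; omega⟩
    rw [abs_of_pos (sub_cast_pos hst)]
    exact W.sub_lt_of_consec O h hus hst (by omega) hle
  · refine ⟨u, h.left_mem, ?_, by rw [abs_lt]; omega⟩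
    rw [abs_sub_comm, abs_of_pos (sub_cast_pos hus)]
    have := W.reflect.sub_lt_of_consec O.reflect h.neg (by omega) (by omega) (by omega) (by omega)
    push_cast at this
    linarith

end Localization

end JumpWindow

section Image

variable {k : ℕ} {f : Fin (k + 2) → ℤ} {a b : ℤ}

lemma consec_image_iff (hf : StrictMono f) :
    Consec (Finset.univ.image f) a b ↔ ∃ j : Fin (k + 1), f j.castSucc = a ∧ f j.succ = b := by
  have hmem (j) : f j ∈ Finset.univ.image f := Finset.mem_image_of_mem f (Finset.mem_univ j)
  constructor
  · intro h
    obtain ⟨i, -, rfl⟩ := Finset.mem_image.1 h.left_mem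
    obtain ⟨i', -, rfl⟩ := Finset.mem_image.1 h.right_mem
    have hi := hf.lt_iff_lt.1 h.lt
    obtain ⟨j, rfl⟩ := Fin.exists_castSucc_eq.2 (hi.trans_le (Fin.le_last i')).ne
    refine ⟨j, rfl, le_antisymm (hf.monotone (Fin.castSucc_lt_iff_succ_le.1 hi)) ?_⟩
    exact (h.le_or_le (hmem j.succ)).resolve_left (hf j.castSucc_lt_succ).not_ge
  · rintro ⟨j, rfl, rfl⟩
    refine ⟨hmem _, hmem _, hf j.castSucc_lt_succ, fun p hp => ?_⟩
    obtain ⟨i, -, rfl⟩ := Finset.mem_image.1 hp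
    exact (le_or_gt i j.castSucc).imp (fun h => hf.monotone h)
      fun h => hf.monotone (Fin.castSucc_lt_iff_succ_le.1 h)

lemma segmentationCost_image (J : ℤ → ℤ → ℝ) (hf : StrictMono f) :
    segmentationCost J (Finset.univ.image f) = ∑ j : Fin (k + 1), J (f j.castSucc) (f j.succ) := by
  have hpairs : consecPairs (Finset.univ.image f) =
      Finset.univ.image fun j : Fin (k + 1) => (f j.castSucc, f j.succ) := by
    ext ⟨a, b⟩
    rw [mem_consecPairs, consec_image_iff hf]
    simp only [Finset.mem_image, Finset.mem_univ, true_and, Prod.mk.injEq]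
  rw [segmentationCost, hpairs, Finset.sum_image]
  exact fun i _ j _ h => Fin.castSucc_injective _ (hf.injective (Prod.mk.inj h).1)

end Image

section PartialSums

variable {n : ℕ} {a b : ℤ}

/-- The coordinates `i : Fin n` whose time `i + 1` is one of `a, …, b - 1`. -/
def timeIco (n : ℕ) (a b : ℤ) : Finset (Fin n) := {i | a ≤ (i : ℤ) + 1 ∧ (i : ℤ) + 1 < b}

/-- The sum of the coordinates of `y` at the times before `p`. -/
def psum (y : Fin n → ℝ) (p : ℤ) : ℝ := ∑ i ∈ timeIco n 1 p, y i

lemma mem_timeIco {i : Fin n} : i ∈ timeIco n a b ↔ a ≤ (i : ℤ) + 1 ∧ (i : ℤ) + 1 < b := by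
  simp [timeIco]

lemma card_timeIco (ha : 1 ≤ a) (hab : a ≤ b) (hb : b ≤ n + 1) :
    ((timeIco n a b).card : ℤ) = b - a := by
  have himage : (timeIco n a b).image (fun i : Fin n => (i : ℤ) + 1) = Finset.Ico a b := by
    ext p
    simp only [Finset.mem_image, mem_timeIco, Finset.mem_Ico]
    constructor
    · rintro ⟨i, hi, rfl⟩
      exact hi
    · exact fun hp => ⟨⟨(p - 1).toNat, by omega⟩, by simp only; omega, by simp only; omega⟩
  have hinj : Function.Injective fun i : Fin n => (i : ℤ) + 1 := fun i j hij =>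
    Fin.ext (by simpa using hij)
  rw [← Finset.card_image_of_injective _ hinj, himage, Int.card_Ico_of_le a b hab]

lemma psum_sub (y : Fin n → ℝ) (hab : a ≤ b) : psum y b - psum y a = ∑ i ∈ timeIco n a b, y i := by
  have hdisj : Disjoint (timeIco n 1 a) (timeIco n a b) :=
    Finset.disjoint_left.2 fun i hi hi' => by
      rw [mem_timeIco] at hi hi'
      omega
  have hunion : timeIco n 1 b = timeIco n 1 a ∪ timeIco n a b := by
    ext i
    rw [Finset.mem_union, mem_timeIco, mem_timeIco, mem_timeIco]
    omega
  rw [psum, psum, hunion, Finset.sum_union hdisj, add_sub_cancel_left]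

lemma psum_add (y z : Fin n → ℝ) (p : ℤ) : psum (y + z) p = psum y p + psum z p :=
  Finset.sum_add_distrib

lemma psum_sub_of_eq {y : Fin n → ℝ} {c : ℝ} (ha : 1 ≤ a) (hab : a ≤ b) (hb : b ≤ n + 1)
    (hy : ∀ i ∈ timeIco n a b, y i = c) : psum y b - psum y a = c * ((b : ℝ) - a) := by
  rw [psum_sub y hab, Finset.sum_congr rfl hy, Finset.sum_const, nsmul_eq_mul, mul_comm]
  congr 1
  exact_mod_cast card_timeIco ha hab hb

lemma sum_sq_sub_timeIco (y : Fin n → ℝ) (c : ℝ) (ha : 1 ≤ a) (hab : a < b) (hb : b ≤ n + 1) :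
    ∑ i ∈ timeIco n a b, (y i - c) ^ 2 = ∑ i ∈ timeIco n a b, y i ^ 2 - explained (psum y) a b +
      ((b : ℝ) - a) * (c - avg (psum y) a b) ^ 2 := by
  have hpos := (sub_cast_pos hab).ne'
  have hcard : ((timeIco n a b).card : ℝ) = b - a := by exact_mod_cast card_timeIco ha hab.le hb
  simp only [sub_sq, Finset.sum_add_distrib, Finset.sum_sub_distrib, ← Finset.sum_mul,
    ← Finset.mul_sum, Finset.sum_const, nsmul_eq_mul, hcard, explained, avg, psum_sub y hab.le]
  field_simp
  ring

lemma segMean_eq_avg (y : EuclideanSpace ℝ (Fin n)) {a b : ℕ} (hab : a ≤ b) :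
    segMean y a b = avg (psum y.ofLp) a b := by
  rw [segMean, avg, psum_sub _ (by exact_mod_cast hab), timeIco, Finset.sum_filter]
  norm_cast

end PartialSums

lemma sum_succ_sub_castSucc {M : Type*} [AddCommGroup M] {k : ℕ} (f : Fin (k + 1) → M) :
    ∑ j : Fin k, (f j.succ - f j.castSucc) = f (Fin.last k) - f 0 := by
  rw [Finset.sum_sub_distrib, sub_eq_sub_iff_add_eq_add, add_comm, ← Fin.sum_univ_succ,
    Fin.sum_univ_castSucc, add_comm]

namespace CPVector

variable {n : ℕ} (τ : CPVector n)

lemma one_le_pt (j : Fin (τ.len + 2)) : 1 ≤ τ.pt j := by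
  rw [← τ.pt_zero]
  exact τ.strictMono.monotone (Fin.zero_le j)

lemma pt_le (j : Fin (τ.len + 2)) : τ.pt j ≤ n + 1 := by
  rw [← τ.pt_last]
  exact τ.strictMono.monotone (Fin.le_last j)

lemma pt_lt (j : Fin (τ.len + 1)) : τ.pt j.castSucc < τ.pt j.succ :=
  τ.strictMono j.castSucc_lt_succ

lemma inSegment_iff {j : Fin (τ.len + 1)} {i : Fin n} :
    τ.InSegment j i ↔ i ∈ timeIco n (τ.pt j.castSucc) (τ.pt j.succ) := by
  rw [InSegment, mem_timeIco]
  norm_cast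

lemma exists_inSegment (j : Fin (τ.len + 1)) : ∃ i, τ.InSegment j i := by
  have h_lt := τ.pt_lt j
  have h_one := τ.one_le_pt j.castSucc
  have h_le := τ.pt_le j.succ
  exact ⟨⟨τ.pt j.castSucc - 1, by omega⟩, by simp only; omega, by simp only; omega⟩

lemma inSegment_unique {j j' : Fin (τ.len + 1)} {i : Fin n} (h : τ.InSegment j i)
    (h' : τ.InSegment j' i) : j = j' := by
  have hle {l l' : Fin (τ.len + 1)} (hl : τ.InSegment l i) (hl' : τ.InSegment l' i) : l ≤ l' := by
    by_contra! hlt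
    exact (hl.1.trans_lt hl'.2).not_ge (τ.strictMono.monotone (Fin.succ_le_castSucc_iff.2 hlt))
  exact le_antisymm (hle h h') (hle h' h)

lemma sum_eq_sum_segments (f : Fin n → ℝ) :
    ∑ i, f i = ∑ j : Fin (τ.len + 1), ∑ i ∈ timeIco n (τ.pt j.castSucc) (τ.pt j.succ), f i := by
  have hsub (j : Fin (τ.len + 1)) := psum_sub f (Nat.cast_le (α := ℤ).2 (τ.pt_lt j).le)
  simp only [← hsub]
  rw [sum_succ_sub_castSucc fun j => psum f (τ.pt j),
    psum_sub f (Nat.cast_le.2 (τ.strictMono.monotone (Fin.zero_le _))), τ.pt_zero, τ.pt_last]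
  refine (Finset.sum_subset (Finset.subset_univ _) fun i _ hi => (hi ?_).elim).symm
  rw [mem_timeIco]
  omega

lemma norm_sub_sq (Y w : EuclideanSpace ℝ (Fin n)) (c : Fin (τ.len + 1) → ℝ)
    (hw : ∀ j i, τ.InSegment j i → w i = c j) :
    ‖Y - w‖ ^ 2 = ‖Y‖ ^ 2 -
        ∑ j : Fin (τ.len + 1), explained (psum Y.ofLp) (τ.pt j.castSucc) (τ.pt j.succ) +
      ∑ j : Fin (τ.len + 1), ((τ.pt j.succ : ℝ) - τ.pt j.castSucc) *
        (c j - avg (psum Y.ofLp) (τ.pt j.castSucc) (τ.pt j.succ)) ^ 2 := by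
  rw [EuclideanSpace.real_norm_sq_eq, EuclideanSpace.real_norm_sq_eq, τ.sum_eq_sum_segments,
    τ.sum_eq_sum_segments fun i => Y i ^ 2, ← Finset.sum_sub_distrib, ← Finset.sum_add_distrib]
  refine Finset.sum_congr rfl fun j _ => ?_
  have hres := sum_sq_sub_timeIco Y.ofLp (c j) (Nat.one_le_cast.2 (τ.one_le_pt j.castSucc))
    (Nat.cast_lt.2 (τ.pt_lt j)) (by exact_mod_cast τ.pt_le j.succ)
  push_cast at hres
  rw [← hres]
  refine Finset.sum_congr rfl fun i hi => ?_
  rw [PiLp.sub_apply, hw j i (τ.inSegment_iff.2 hi)]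

lemma exists_mem_pieceSpace (c : Fin (τ.len + 1) → ℝ) :
    ∃ w ∈ τ.pieceSpace, ∀ j i, τ.InSegment j i → w i = c j := by
  classical
  let w : EuclideanSpace ℝ (Fin n) :=
    WithLp.toLp 2 fun i => ∑ j, if τ.InSegment j i then c j else 0
  have hw (j i) (h : τ.InSegment j i) : w i = c j := by
    change (∑ j, if τ.InSegment j i then c j else 0) = c j
    rw [Finset.sum_eq_single j, if_pos h]
    · exact fun j' _ hj' => if_neg fun h' => hj' (τ.inSegment_unique h' h)
    · exact fun hj => (hj (Finset.mem_univ j)).elim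
  exact ⟨w, fun j i i' h h' => by rw [hw j i h, hw j i' h'], hw⟩

lemma exists_eq_of_mem_pieceSpace {w : EuclideanSpace ℝ (Fin n)} (hw : w ∈ τ.pieceSpace) :
    ∃ c : Fin (τ.len + 1) → ℝ, ∀ j i, τ.InSegment j i → w i = c j := by
  choose f hf using τ.exists_inSegment
  exact ⟨fun j => w (f j), fun j i h => hw j i _ h (hf j)⟩

lemma norm_sub_starProjection_sq (Y : EuclideanSpace ℝ (Fin n)) :
    ‖Y - τ.pieceSpace.starProjection Y‖ ^ 2 = ‖Y‖ ^ 2 -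
      ∑ j : Fin (τ.len + 1), explained (psum Y.ofLp) (τ.pt j.castSucc) (τ.pt j.succ) := by
  apply le_antisymm
  · obtain ⟨w, hw, hwc⟩ := τ.exists_mem_pieceSpace fun j =>
      avg (psum Y.ofLp) (τ.pt j.castSucc) (τ.pt j.succ)
    have hmin : ‖Y - τ.pieceSpace.starProjection Y‖ ≤ ‖Y - w‖ := by
      rw [Submodule.starProjection_minimal]
      exact ciInf_le ⟨0, Set.forall_mem_range.2 fun _ => norm_nonneg _⟩ (⟨w, hw⟩ : τ.pieceSpace)
    have hsq := pow_le_pow_left₀ (norm_nonneg _) hmin 2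
    rw [τ.norm_sub_sq Y w _ hwc] at hsq
    simpa using hsq
  · obtain ⟨c, hc⟩ := τ.exists_eq_of_mem_pieceSpace (τ.pieceSpace.starProjection_apply_mem Y)
    rw [τ.norm_sub_sq Y _ c hc]
    refine le_add_of_nonneg_right (Finset.sum_nonneg fun j _ => mul_nonneg ?_ (sq_nonneg _))
    exact sub_nonneg.2 (Nat.cast_le.2 (τ.pt_lt j).le)

/-- The points `τ₀, …, τ_{len+1}` as a set of integers, end points included. -/
def nodes : Finset ℤ := Finset.univ.image fun j => (τ.pt j : ℤ)

lemma mem_nodes {p : ℤ} : p ∈ τ.nodes ↔ ∃ j, (τ.pt j : ℤ) = p := by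
  simp [nodes]

lemma one_mem_nodes : 1 ∈ τ.nodes := τ.mem_nodes.2 ⟨0, by simp [τ.pt_zero]⟩

lemma last_mem_nodes : (n : ℤ) + 1 ∈ τ.nodes :=
  τ.mem_nodes.2 ⟨Fin.last _, by simp [τ.pt_last]⟩

lemma nodes_subset_Icc : τ.nodes ⊆ Finset.Icc 1 ((n : ℤ) + 1) := fun p hp => by
  obtain ⟨j, rfl⟩ := τ.mem_nodes.1 hp
  exact Finset.mem_Icc.2 ⟨by exact_mod_cast τ.one_le_pt j, by exact_mod_cast τ.pt_le j⟩

lemma criterion_eq (L q : ℝ) (Y : EuclideanSpace ℝ (Fin n)) :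
    τ.criterion L q Y =
      ‖Y‖ ^ 2 - L * q + segmentationCost (segCost (psum Y.ofLp) n L q) τ.nodes := by
  have hmono : StrictMono fun j => (τ.pt j : ℤ) := Nat.strictMono_cast.comp τ.strictMono
  rw [nodes, segmentationCost_image _ hmono, criterion, penalty, τ.norm_sub_starProjection_sq]
  simp only [segCost, mul_add, Finset.sum_add_distrib, Finset.sum_neg_distrib, ← Finset.mul_sum,
    Finset.sum_const, Finset.card_univ, Fintype.card_fin, nsmul_eq_mul, Int.cast_natCast]
  push_cast
  ring

lemma exists_nodes_eq (hn : n ≠ 0) {M : Finset ℤ} (h_one : 1 ∈ M) (h_last : (n : ℤ) + 1 ∈ M)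
    (hM : M ⊆ Finset.Icc 1 ((n : ℤ) + 1)) : ∃ σ : CPVector n, σ.nodes = M := by
  obtain ⟨k, hk⟩ : ∃ k, M.card = k + 2 := Nat.exists_eq_add_of_le' (Finset.one_lt_card.2
    ⟨1, h_one, (n : ℤ) + 1, h_last, by omega⟩)
  let e := M.orderEmbOfFin hk
  have hbound (j) : 1 ≤ e j ∧ e j ≤ n + 1 := Finset.mem_Icc.1 (hM (M.orderEmbOfFin_mem hk j))
  have hsurj {p : ℤ} (hp : p ∈ M) : ∃ j, e j = p := by
    rwa [← Finset.mem_coe, ← M.range_orderEmbOfFin hk] at hp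
  have hcast (j) : ((e j).toNat : ℤ) = e j := Int.toNat_of_nonneg (by linarith [(hbound j).1])
  have hzero : e 0 ≤ 1 := by
    obtain ⟨j, hj⟩ := hsurj h_one
    exact hj ▸ e.monotone (Fin.zero_le j)
  have hlast : (n : ℤ) + 1 ≤ e (Fin.last _) := by
    obtain ⟨j, hj⟩ := hsurj h_last
    exact hj ▸ e.monotone (Fin.le_last j)
  refine ⟨⟨k, fun j => (e j).toNat, fun i j hij => ?_, ?_, ?_⟩, ?_⟩
  · change (e i).toNat < (e j).toNat
    have := e.strictMono hij
    have := hcast i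
    have := hcast j
    omega
  · have := hbound 0
    omega
  · have := hbound (Fin.last _)
    omega
  · ext p
    simp only [mem_nodes, hcast]
    exact ⟨fun ⟨j, hj⟩ => hj ▸ M.orderEmbOfFin_mem hk j, hsurj⟩

end CPVector

lemma IsPenalizedLSE.isOptimalSegmentation {n : ℕ} {L q : ℝ} {Y : EuclideanSpace ℝ (Fin n)}
    {τ : CPVector n} (hn : n ≠ 0) (h : IsPenalizedLSE L q Y τ) :
    IsOptimalSegmentation (psum Y.ofLp) n L q 1 (n + 1) τ.nodes where
  lo_mem := τ.one_mem_nodes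
  hi_mem := τ.last_mem_nodes
  subset_Icc := τ.nodes_subset_Icc
  cost_le M h_one h_last hM := by
    obtain ⟨σ, rfl⟩ := CPVector.exists_nodes_eq hn h_one h_last hM
    have hle := h σ
    rw [τ.criterion_eq, σ.criterion_eq] at hle
    linarith

section MaximalInequality

variable {Ω ι : Type*} {mΩ : MeasurableSpace Ω} {P : Measure Ω} {X : ι → Ω → ℝ}
  {A : ℕ → Finset ι}

lemma integrable_finsetProd_of_iIndepFun [IsFiniteMeasure P] (hX : ∀ i, Measurable (X i))
    (hind : iIndepFun X P) (hint : ∀ i, Integrable (X i) P) (s : Finset ι) :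
    Integrable (∏ i ∈ s, X i) P := by
  classical
  induction s using Finset.induction_on with
  | empty => exact integrable_const 1
  | insert i s hi ih =>
    rw [Finset.prod_insert hi]
    exact (hind.indepFun_finsetProd_of_notMem hX hi).symm.integrable_mul (hint i) ih

lemma integral_finsetProd_of_iIndepFun (hX : ∀ i, Measurable (X i)) (hind : iIndepFun X P)
    (s : Finset ι) : ∫ ω, (∏ i ∈ s, X i) ω ∂P = ∏ i ∈ s, ∫ ω, X i ω ∂P := by
  simp only [Finset.prod_apply, ← Finset.prod_coe_sort s]
  exact (hind.precomp Subtype.val_injective).integral_fun_prod_eq_prod_integral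
    fun i => (hX i).aestronglyMeasurable

lemma stronglyMeasurable_finsetProd_iSup_comap {s : Finset ι} {T : Set ι} (hs : ↑s ⊆ T) :
    StronglyMeasurable[⨆ i ∈ T, MeasurableSpace.comap (X i) inferInstance] (∏ i ∈ s, X i) := by
  refine Finset.stronglyMeasurable_prod _ fun i hi => Measurable.stronglyMeasurable ?_
  exact (comap_measurable (X i)).mono (le_iSup₂_of_le i (hs hi) le_rfl) le_rfl

/-- The filtration whose `d`-th term is generated by the variables indexed by `A d`. -/
def finsetFiltration (hX : ∀ i, Measurable (X i)) (hA : Monotone A) : Filtration ℕ mΩ where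
  seq d := ⨆ i ∈ (A d : Set ι), MeasurableSpace.comap (X i) inferInstance
  mono' _ _ hd := biSup_mono fun _ hi => hA hd hi
  le' _ := iSup₂_le fun i _ => (hX i).comap_le

lemma martingale_finsetProd [IsProbabilityMeasure P] (hX : ∀ i, Measurable (X i))
    (hind : iIndepFun X P) (hint : ∀ i, Integrable (X i) P) (hmean : ∀ i, ∫ ω, X i ω ∂P = 1)
    (hA : Monotone A) : Martingale (fun d => ∏ i ∈ A d, X i) (finsetFiltration hX hA) P := by
  classical
  have hprod (s : Finset ι) := integrable_finsetProd_of_iIndepFun hX hind hint s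
  refine martingale_nat (fun d => stronglyMeasurable_finsetProd_iSup_comap subset_rfl)
    (fun d => hprod (A d)) fun d => ?_
  have hsplit : ∏ i ∈ A (d + 1), X i = (∏ i ∈ A d, X i) * ∏ i ∈ A (d + 1) \ A d, X i := by
    rw [mul_comm, Finset.prod_sdiff (hA d.le_succ)]
  have hpull := condExp_mul_of_stronglyMeasurable_left (m := finsetFiltration hX hA d)
    (stronglyMeasurable_finsetProd_iSup_comap subset_rfl) (hsplit ▸ hprod (A (d + 1)))
    (hprod (A (d + 1) \ A d))
  have hnew : P[∏ i ∈ A (d + 1) \ A d, X i | finsetFiltration hX hA d] =ᵐ[P] fun _ => 1 := by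
    have hindep := indep_iSup_of_disjoint (fun i => (hX i).comap_le) hind
      (Finset.disjoint_coe.2 (Finset.sdiff_disjoint (s := A d) (t := A (d + 1))))
    have hconst := condExp_indep_eq (iSup₂_le fun i _ => (hX i).comap_le)
      ((finsetFiltration hX hA).le d) (stronglyMeasurable_finsetProd_iSup_comap subset_rfl) hindep
    rwa [integral_finsetProd_of_iIndepFun hX hind, Finset.prod_congr rfl fun i _ => hmean i,
      Finset.prod_const_one] at hconst
  filter_upwards [hpull, hnew] with ω hω hω'
  rw [hsplit, hω, Pi.mul_apply, hω', mul_one]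

lemma measure_exists_le_finsetProd_le [IsProbabilityMeasure P] (hX : ∀ i, Measurable (X i))
    (hind : iIndepFun X P) (hint : ∀ i, Integrable (X i) P) (hmean : ∀ i, ∫ ω, X i ω ∂P = 1)
    (hnonneg : ∀ i, 0 ≤ X i) (hA : Monotone A) {a : ℝ} (ha : 0 < a) (N : ℕ) :
    P {ω | ∃ d ≤ N, a ≤ ∏ i ∈ A d, X i ω} ≤ ENNReal.ofReal a⁻¹ := by
  lift a to ℝ≥0 using ha.le
  have hprod := integrable_finsetProd_of_iIndepFun hX hind hint (A N)
  have hprod_nonneg (d) : 0 ≤ ∏ i ∈ A d, X i := Finset.prod_nonneg fun i _ => hnonneg i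
  have hmax := maximal_ineq (martingale_finsetProd hX hind hint hmean hA).submartingale
    hprod_nonneg (ε := a) N
  have hmass : ∫ ω, (∏ i ∈ A N, X i) ω ∂P = 1 := by
    rw [integral_finsetProd_of_iIndepFun hX hind, Finset.prod_congr rfl fun i _ => hmean i,
      Finset.prod_const_one]
  have hmul : ENNReal.ofReal a * P {ω | ∃ d ≤ N, a ≤ ∏ i ∈ A d, X i ω} ≤ 1 := by
    rw [← ENNReal.ofReal_one, ← hmass]
    refine le_trans ?_ (hmax.trans (ENNReal.ofReal_le_ofReal
      (setIntegral_le_integral hprod (ae_of_all _ (hprod_nonneg N)))))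
    simp [Finset.le_sup'_iff]
  rwa [ENNReal.ofReal_inv_of_pos ha, ENNReal.le_inv_iff_mul_le, mul_comm]

lemma measure_exists_mul_card_lt_sum_le [IsProbabilityMeasure P] {ε : ι → Ω → ℝ}
    (hε : ∀ i, Measurable (ε i)) (hind : iIndepFun ε P) {c : ℝ≥0}
    (hsub : ∀ i, HasSubgaussianMGF (ε i) c P) (hA : Monotone A) {l : ℝ} (hl : 0 ≤ l) (r : ℝ)
    (N : ℕ) :
    P {ω | ∃ d ≤ N, r ≤ (A d).card ∧ c * l * (A d).card < ∑ i ∈ A d, ε i ω} ≤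
      ENNReal.ofReal (Real.exp (-(c * l ^ 2 / 2 * r))) := by
  let g (i : ι) (t : ℝ) : ℝ := Real.exp (l * t - cgf (ε i) P l)
  have hg (i) : Measurable (g i) := by fun_prop
  have hexp (i) : g i ∘ ε i = fun ω => Real.exp (l * ε i ω) / mgf (ε i) P l := by
    ext ω
    rw [← exp_cgf ((hsub i).integrable_exp_mul l), ← Real.exp_sub, Function.comp_apply]
  have hville := measure_exists_le_finsetProd_le (X := fun i => g i ∘ ε i)
    (fun i => (hg i).comp (hε i)) (hind.comp g hg)
    (fun i => hexp i ▸ ((hsub i).integrable_exp_mul l).div_const _)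
    (fun i => by
      rw [hexp i, integral_div]
      exact div_self (mgf_pos ((hsub i).integrable_exp_mul l)).ne')
    (fun i ω => (Real.exp_pos _).le) hA (Real.exp_pos (c * l ^ 2 / 2 * r)) N
  rw [← Real.exp_neg] at hville
  refine (measure_mono ?_).trans hville
  rintro ω ⟨d, hd, hr, hlt⟩
  refine ⟨d, hd, ?_⟩
  have hcgf : ∑ i ∈ A d, cgf (ε i) P l ≤ c * l ^ 2 / 2 * (A d).card := by
    rw [mul_comm, ← nsmul_eq_mul]
    exact Finset.sum_le_card_nsmul _ _ _ fun i _ => (hsub i).cgf_le l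
  simp only [Function.comp_apply, g, ← Real.exp_sum, Finset.sum_sub_distrib, ← Finset.mul_sum]
  refine Real.exp_le_exp.2 ?_
  calc c * l ^ 2 / 2 * r ≤ c * l ^ 2 / 2 * (A d).card := by gcongr
    _ = l * (c * l * (A d).card) - c * l ^ 2 / 2 * (A d).card := by ring
    _ ≤ _ := by gcongr

lemma measure_exists_mul_card_lt_abs_sum_le [IsProbabilityMeasure P] {ε : ι → Ω → ℝ}
    (hε : ∀ i, Measurable (ε i)) (hind : iIndepFun ε P) {c : ℝ≥0}
    (hsub : ∀ i, HasSubgaussianMGF (ε i) c P) (hA : Monotone A) {l : ℝ} (hl : 0 ≤ l) (r : ℝ)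
    (N : ℕ) :
    P {ω | ∃ d ≤ N, r ≤ (A d).card ∧ c * l * (A d).card < |∑ i ∈ A d, ε i ω|} ≤
      ENNReal.ofReal (2 * Real.exp (-(c * l ^ 2 / 2 * r))) := by
  have hupper := measure_exists_mul_card_lt_sum_le hε hind hsub hA hl r N
  have hlower := measure_exists_mul_card_lt_sum_le (ε := fun i => -ε i) (fun i => (hε i).neg)
    (hind.comp (fun _ t => -t) fun _ => measurable_neg) (fun i => (hsub i).neg) hA hl r N
  rw [two_mul, ENNReal.ofReal_add (Real.exp_nonneg _) (Real.exp_nonneg _)]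
  refine (measure_mono ?_).trans ((measure_union_le _ _).trans (add_le_add hupper hlower))
  rintro ω ⟨d, hd, hr, hlt⟩
  refine (lt_abs.1 hlt).imp (fun h => ⟨d, hd, hr, h⟩) fun h => ⟨d, hd, hr, ?_⟩
  simpa using h

end MaximalInequality

section NoiseDeviation

variable {n s : ℕ}

lemma monotone_timeIco_forward (n s : ℕ) : Monotone fun d : ℕ => timeIco n s (s + d) :=
  fun d d' hd i hi => by
    rw [mem_timeIco] at hi ⊢
    omega

lemma monotone_timeIco_backward (n s : ℕ) : Monotone fun d : ℕ => timeIco n (s - d) s :=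
  fun d d' hd i hi => by
    rw [mem_timeIco] at hi ⊢
    omega

lemma measure_exists_mul_lt_abs_psum_sub_le {Ω : Type*} [MeasurableSpace Ω] {P : Measure Ω}
    [IsProbabilityMeasure P] {ε : Fin n → Ω → ℝ} (hε : ∀ i, Measurable (ε i))
    (hind : iIndepFun ε P) {c : ℝ≥0} (hsub : ∀ i, HasSubgaussianMGF (ε i) c P) (hs : 1 ≤ s)
    (hsn : s ≤ n + 1) {l : ℝ} (hl : 0 ≤ l) (r : ℝ) :
    P {ω | ∃ p : ℤ, 1 ≤ p ∧ p ≤ n + 1 ∧ r ≤ |(p : ℝ) - s| ∧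
        c * l * |(p : ℝ) - s| < |psum (fun i => ε i ω) p - psum (fun i => ε i ω) s|} ≤
      ENNReal.ofReal (4 * Real.exp (-(c * l ^ 2 / 2 * r))) := by
  have hright := measure_exists_mul_card_lt_abs_sum_le hε hind hsub
    (monotone_timeIco_forward n s) hl r n
  have hleft := measure_exists_mul_card_lt_abs_sum_le hε hind hsub
    (monotone_timeIco_backward n s) hl r n
  rw [show (4 : ℝ) = 2 + 2 by norm_num, add_mul, ENNReal.ofReal_add (by positivity) (by positivity)]
  refine (measure_mono ?_).trans ((measure_union_le _ _).trans (add_le_add hright hleft))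
  rintro ω ⟨p, hp, hpn, hr, hlt⟩
  rcases le_total (s : ℤ) p with hsp | hps
  · refine Or.inl ⟨(p - s).toNat, by omega, ?_⟩
    have hcard := card_timeIco (n := n) (Nat.one_le_cast.2 hs) hsp hpn
    rw [show (s : ℤ) + (p - s).toNat = p by omega, ← psum_sub _ hsp]
    rw [← Int.cast_natCast, ← Int.cast_sub, ← hcard] at hr hlt
    simpa using And.intro hr hlt
  · refine Or.inr ⟨(s - p).toNat, by omega, ?_⟩
    have hcard := card_timeIco (n := n) hp hps (by omega)
    rw [show (s : ℤ) - (s - p).toNat = p by omega, ← psum_sub _ hps]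
    rw [abs_sub_comm (p : ℝ), ← Int.cast_natCast, ← Int.cast_sub, ← hcard] at hr hlt
    rw [abs_sub_comm (psum _ p)] at hlt
    simpa using And.intro hr hlt

end NoiseDeviation

section Energy

variable {n : ℕ} {a b c : ℕ} {q : ℝ}

lemma cusum_sq (y : EuclideanSpace ℝ (Fin n)) (hab : a < b) (hbc : b < c) :
    cusum y a b c ^ 2 = cusumSq (psum y.ofLp) a b c := by
  have hx := sub_cast_pos (Nat.cast_lt (α := ℤ).2 hab)
  have hy := sub_cast_pos (Nat.cast_lt (α := ℤ).2 hbc)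
  have hxy := sub_cast_pos (Nat.cast_lt (α := ℤ).2 (hab.trans hbc))
  rw [cusumSq_eq _ (Nat.cast_lt.2 hab) (Nat.cast_lt.2 hbc), cusum, segMean_eq_avg y hab.le,
    segMean_eq_avg y hbc.le, mul_pow, Real.sq_sqrt (by positivity)]
  norm_cast

lemma energy_sq (θ : EuclideanSpace ℝ (Fin n)) (a b c : ℕ) :
    energy θ a b c ^ 2 = cusum θ a b c ^ 2 := by
  rw [energy, cusum, mul_pow, mul_pow, sq_abs]

lemma threshold_sq (hq : 0 ≤ q) (hab : a < b) (hbc : b < c) (hcn : c ≤ n + b) :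
    threshold n q a b c ^ 2 = thresholdSq n q a b c := by
  have hx : (0 : ℝ) < (b : ℝ) - a := sub_pos.2 (Nat.cast_lt.2 hab)
  have hy : (0 : ℝ) < (c : ℝ) - b := sub_pos.2 (Nat.cast_lt.2 hbc)
  have hxy : (0 : ℝ) < (c : ℝ) - a := by linarith
  have hyn : (c : ℝ) - b ≤ n := sub_le_iff_le_add.2 (by exact_mod_cast hcn)
  have hn : (0 : ℝ) < n := hy.trans_le hyn
  have hlog : 0 ≤ Real.log ((n * ((c : ℝ) - a)) / (((c : ℝ) - b) * ((b : ℝ) - a))) := by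
    refine Real.log_nonneg ((one_le_div (by positivity)).2 ?_)
    exact mul_le_mul hyn (by linarith) hx.le hn.le
  rw [threshold, Real.sq_sqrt (by positivity), thresholdSq,
    Real.log_div (by positivity) (by positivity), Real.log_mul hn.ne' hxy.ne',
    Real.log_mul hy.ne' hx.ne']
  push_cast
  ring

end Energy

section HighEnergy

variable {n : ℕ} {θ : EuclideanSpace ℝ (Fin n)} {τ : CPVector n} {μ : Fin (τ.len + 1) → ℝ}
  {k : Fin τ.len} {κ L q r : ℝ}

namespace CPVector

lemma prev_lt (τ : CPVector n) (k : Fin τ.len) : τ.prev k < τ.cp k :=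
  τ.pt_lt k.castSucc

lemma lt_next (τ : CPVector n) (k : Fin τ.len) : τ.cp k < τ.next k :=
  τ.pt_lt k.succ

lemma one_le_prev (τ : CPVector n) (k : Fin τ.len) : 1 ≤ τ.prev k :=
  τ.one_le_pt _

lemma next_le (τ : CPVector n) (k : Fin τ.len) : τ.next k ≤ n + 1 :=
  τ.pt_le _

/-- The distance from `τ.cp k` to the nearest of its two neighbours in `τ`. -/
def gap (τ : CPVector n) (k : Fin τ.len) : ℤ :=
  min ((τ.cp k : ℤ) - τ.prev k) ((τ.next k : ℤ) - τ.cp k)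

lemma gap_pos (τ : CPVector n) (k : Fin τ.len) : 0 < τ.gap k :=
  lt_min (sub_pos.2 (Nat.cast_lt.2 (τ.prev_lt k))) (sub_pos.2 (Nat.cast_lt.2 (τ.lt_next k)))

lemma prev_le_sub_gap (τ : CPVector n) (k : Fin τ.len) : (τ.prev k : ℤ) ≤ τ.cp k - τ.gap k :=
  le_sub_comm.1 (min_le_left _ _)

lemma add_gap_le_next (τ : CPVector n) (k : Fin τ.len) : (τ.cp k : ℤ) + τ.gap k ≤ τ.next k :=
  le_sub_iff_add_le'.1 (min_le_right _ _)

lemma gap_eq_or (τ : CPVector n) (k : Fin τ.len) :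
    (τ.gap k : ℝ) = (τ.cp k : ℝ) - τ.prev k ∨ (τ.gap k : ℝ) = (τ.next k : ℝ) - τ.cp k := by
  unfold gap
  exact_mod_cast min_choice ((τ.cp k : ℤ) - τ.prev k) ((τ.next k : ℤ) - τ.cp k)

lemma exists_cp_eq {p : ℤ} (hp : p ∈ τ.nodes) (h_one : 1 < p) (h_last : p < n + 1) :
    ∃ j, (τ.cp j : ℤ) = p := by
  obtain ⟨j, rfl⟩ := τ.mem_nodes.1 hp
  cases j using Fin.cases with
  | zero => simp [τ.pt_zero] at h_one
  | succ j =>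
    cases j using Fin.lastCases with
    | last => simp [τ.pt_last] at h_last
    | cast j => exact ⟨j, rfl⟩

lemma dist1_lt {s : ℕ} {p : ℤ} (hp : p ∈ τ.nodes) (h_one : 1 < p) (h_last : p < n + 1)
    (hps : |(p : ℝ) - s| < r) : τ.dist1 s < ENNReal.ofReal r := by
  obtain ⟨j, rfl⟩ := exists_cp_eq hp h_one h_last
  refine (iInf_le _ j).trans_lt ?_
  rwa [ENNReal.ofReal_lt_ofReal_iff_of_nonneg (abs_nonneg _), ← Int.cast_natCast]

end CPVector

lemma IsChangePointRep.psum_sub (h : IsChangePointRep θ τ μ) (j : Fin (τ.len + 1)) {a b : ℤ}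
    (ha : (τ.pt j.castSucc : ℤ) ≤ a) (hab : a ≤ b) (hb : b ≤ τ.pt j.succ) :
    psum θ.ofLp b - psum θ.ofLp a = μ j * ((b : ℝ) - a) := by
  have h_one := τ.one_le_pt j.castSucc
  have h_le := τ.pt_le j.succ
  refine psum_sub_of_eq (by omega) hab (by omega) fun i hi => h.2 j i (τ.inSegment_iff.2 ?_)
  rw [mem_timeIco] at hi ⊢
  omega

lemma IsChangePointRep.avg_psum (h : IsChangePointRep θ τ μ) (j : Fin (τ.len + 1)) :
    avg (psum θ.ofLp) (τ.pt j.castSucc) (τ.pt j.succ) = μ j := by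
  have hlt := Nat.cast_lt (α := ℤ).2 (τ.pt_lt j)
  rw [avg, h.psum_sub j le_rfl hlt.le le_rfl, mul_div_cancel_right₀ _ (sub_cast_pos hlt).ne']

lemma IsChangePointRep.cusumSq_le (h : IsChangePointRep θ τ μ) (k : Fin τ.len) :
    cusumSq (psum θ.ofLp) (τ.prev k) (τ.cp k) (τ.next k) ≤
      (μ k.succ - μ k.castSucc) ^ 2 * τ.gap k := by
  have hlt := Nat.cast_lt (α := ℤ).2 (τ.prev_lt k)
  have hlt' := Nat.cast_lt (α := ℤ).2 (τ.lt_next k)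
  have hleft : avg (psum θ.ofLp) (τ.prev k) (τ.cp k) = μ k.castSucc := h.avg_psum k.castSucc
  have hright : avg (psum θ.ofLp) (τ.cp k) (τ.next k) = μ k.succ := h.avg_psum k.succ
  rw [← hleft, ← hright]
  rcases τ.gap_eq_or k with hgap | hgap <;> rw [hgap]
  · exact_mod_cast cusumSq_le_left _ hlt hlt'
  · exact_mod_cast cusumSq_le_right _ hlt hlt'

lemma CPVector.le_thresholdSq_gap (τ : CPVector n) (k : Fin τ.len) (q : ℝ) :
    q + 2 * Real.log (n / τ.gap k) ≤ thresholdSq n q (τ.prev k) (τ.cp k) (τ.next k) := by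
  have hlt := Nat.cast_lt (α := ℤ).2 (τ.prev_lt k)
  have hlt' := Nat.cast_lt (α := ℤ).2 (τ.lt_next k)
  have hn : n ≠ 0 := by
    have := τ.one_le_prev k
    have := τ.next_le k
    omega
  rw [Real.log_div (Nat.cast_ne_zero.2 hn) (Int.cast_ne_zero.2 (τ.gap_pos k).ne')]
  rcases τ.gap_eq_or k with hgap | hgap <;> rw [hgap]
  · exact_mod_cast le_thresholdSq n q hlt hlt'
  · have h := le_thresholdSq n q (neg_lt_neg hlt') (neg_lt_neg hlt)
    rw [thresholdSq_neg] at h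
    simpa only [Int.cast_neg, neg_sub_neg, Int.cast_natCast] using h

lemma IsHighEnergy.mul_thresholdSq_le (h : IsHighEnergy κ q θ τ k) (hκ : 0 ≤ κ) (hq : 0 ≤ q) :
    κ ^ 2 * thresholdSq n q (τ.prev k) (τ.cp k) (τ.next k) ≤
      cusumSq (psum θ.ofLp) (τ.prev k) (τ.cp k) (τ.next k) := by
  have hprev := τ.prev_lt k
  have hnext := τ.lt_next k
  have hsq := pow_le_pow_left₀ (mul_nonneg hκ (Real.sqrt_nonneg _)) h.le 2
  have h_le : τ.next k ≤ n + τ.cp k := by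
    have := τ.next_le k
    have := τ.one_le_prev k
    omega
  rwa [← threshold, mul_pow, threshold_sq hq hprev hnext h_le, energy_sq,
    cusum_sq θ hprev hnext] at hsq

lemma IsHighEnergy.mul_log_le (h : IsHighEnergy κ q θ τ k) (hrep : IsChangePointRep θ τ μ)
    (hκ : 0 ≤ κ) (hq : 0 ≤ q) (hL : 0 ≤ L) (hLκ : L ≤ κ ^ 2) :
    L * (q + 2 * Real.log (n / τ.gap k)) ≤ (μ k.succ - μ k.castSucc) ^ 2 * τ.gap k := by
  have hthreshold : 0 ≤ thresholdSq n q (τ.prev k) (τ.cp k) (τ.next k) := by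
    have h_le : τ.next k ≤ n + τ.cp k := by
      have := τ.next_le k
      have := τ.one_le_prev k
      have := τ.prev_lt k
      omega
    rw [← threshold_sq hq (τ.prev_lt k) (τ.lt_next k) h_le]
    exact sq_nonneg _
  calc L * (q + 2 * Real.log (n / τ.gap k))
      ≤ L * thresholdSq n q (τ.prev k) (τ.cp k) (τ.next k) :=
        mul_le_mul_of_nonneg_left (τ.le_thresholdSq_gap k q) hL
    _ ≤ κ ^ 2 * thresholdSq n q (τ.prev k) (τ.cp k) (τ.next k) :=
        mul_le_mul_of_nonneg_right hLκ hthreshold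
    _ ≤ cusumSq (psum θ.ofLp) (τ.prev k) (τ.cp k) (τ.next k) := h.mul_thresholdSq_le hκ hq
    _ ≤ (μ k.succ - μ k.castSucc) ^ 2 * τ.gap k := hrep.cusumSq_le k

lemma IsHighEnergy.jumpWindow {Z : EuclideanSpace ℝ (Fin n)} (h : IsHighEnergy κ q θ τ k)
    (hrep : IsChangePointRep θ τ μ) (hκ : 0 ≤ κ) (hL : 100 ≤ L) (hLκ : 1000000 * L ≤ κ ^ 2)
    (hq : 10 < q) (hr : 0 < r)
    (hnoise : ∀ t₁ t₂ t₃ : ℕ, 1 ≤ t₁ → t₁ < t₂ → t₂ < t₃ → t₃ ≤ n + 1 →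
      |cusum Z t₁ t₂ t₃| ≤ 2 * threshold n q t₁ t₂ t₃)
    (hdev : ∀ p : ℤ, 1 ≤ p → p ≤ n + 1 → r ≤ |(p : ℝ) - τ.cp k| →
      |psum Z.ofLp p - psum Z.ofLp (τ.cp k)| ≤
        1 / 16 * |μ k.succ - μ k.castSucc| * |(p : ℝ) - τ.cp k|) :
    JumpWindow (psum (θ + Z).ofLp) (psum Z.ofLp) n L q (μ k.castSucc) (μ k.succ) r (τ.cp k)
      (τ.gap k) 1 (n + 1) := by
  have hlo : 1 ≤ (τ.cp k : ℤ) - τ.gap k :=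
    (Nat.one_le_cast.2 (τ.one_le_prev k)).trans (τ.prev_le_sub_gap k)
  have hhi : (τ.cp k : ℤ) + τ.gap k ≤ n + 1 :=
    (τ.add_gap_le_next k).trans (by exact_mod_cast τ.next_le k)
  have hsplit (p) : psum (θ + Z).ofLp p = psum θ.ofLp p + psum Z.ofLp p := psum_add _ _ p
  refine ⟨hL, hq, τ.gap_pos k, hlo, hhi, by simp, hr, fun p hp hps => ?_, fun p hps hp => ?_,
    h.mul_log_le hrep hκ (by linarith) (by linarith) hLκ, fun a b c ha hab hbc hc => ?_,
    fun p hp hp' hpr => by simpa using hdev p (by omega) (by omega) (by simpa using hpr)⟩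
  · have := hrep.psum_sub k.castSucc ((τ.prev_le_sub_gap k).trans hp) hps le_rfl
    rw [hsplit, hsplit]
    linarith
  · have := hrep.psum_sub k.succ (a := τ.cp k) le_rfl hps (hp.trans (τ.add_gap_le_next k))
    rw [hsplit, hsplit]
    linarith
  · lift a to ℕ using by omega
    lift b to ℕ using by omega
    lift c to ℕ using by omega
    rw [Nat.cast_lt] at hab hbc
    have hsq := pow_le_pow_left₀ (abs_nonneg _) (hnoise a b c (by omega) hab hbc (by omega)) 2
    rw [sq_abs, cusum_sq Z hab hbc, mul_pow,
      threshold_sq (by linarith) hab hbc (by omega)] at hsq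
    linarith

lemma IsPenalizedLSE.dist1_lt {Y : EuclideanSpace ℝ (Fin n)} {E : ℤ → ℝ} {μ₁ μ₂ : ℝ} {s : ℕ}
    {m : ℤ} (hτ : IsPenalizedLSE L q Y τ)
    (W : JumpWindow (psum Y.ofLp) E n L q μ₁ μ₂ r s m 1 (n + 1)) :
    τ.dist1 s < ENNReal.ofReal r := by
  have hlo := W.lo_le
  have hhi := W.le_hi
  have hm := W.one_le
  obtain ⟨p, hp, hpr, hpm⟩ := W.exists_mem_abs_sub_lt (hτ.isOptimalSegmentation (by omega))
  rw [abs_lt] at hpm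
  exact CPVector.dist1_lt hp (by omega) (by omega) (by simpa using hpr)

lemma IsHighEnergy.measure_le_dist1_le {Ω : Type*} [MeasurableSpace Ω] {P : Measure Ω}
    [IsProbabilityMeasure P] {ε : Fin n → Ω → ℝ} {τhat : Ω → CPVector n}
    (h : IsHighEnergy κ q θ τ k) (hrep : IsChangePointRep θ τ μ)
    (hκ : 0 ≤ κ) (hL : 100 ≤ L) (hLκ : 1000000 * L ≤ κ ^ 2) (hq : 10 < q)
    (hε : ∀ i, Measurable (ε i)) (hind : iIndepFun ε P) (hsub : ∀ i, HasSubgaussianMGF (ε i) 1 P)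
    (hτhat : ∀ ω, IsPenalizedLSE L q (θ + noiseVec ε ω) (τhat ω)) (hr : 0 < r) :
    P {ω | ENNReal.ofReal r ≤
        (noiseEvent ε q).indicator (fun ω => (τhat ω).dist1 (τ.cp k)) ω} ≤
      ENNReal.ofReal (4 * Real.exp (-((μ k.succ - μ k.castSucc) ^ 2 / 512 * r))) := by
  have hbound := measure_exists_mul_lt_abs_psum_sub_le hε hind hsub (s := τ.cp k)
    (τ.one_le_pt _) (τ.pt_le _)
    (show 0 ≤ 1 / 16 * |μ k.succ - μ k.castSucc| by positivity) r
  have hrate : (1 : ℝ≥0) * (1 / 16 * |μ k.succ - μ k.castSucc|) ^ 2 / 2 =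
      (μ k.succ - μ k.castSucc) ^ 2 / 512 := by
    rw [mul_pow, sq_abs, NNReal.coe_one]
    ring
  rw [hrate] at hbound
  refine (measure_mono fun ω hω => ?_).trans hbound
  have hmem : ω ∈ noiseEvent ε q := by
    by_contra hnot
    rw [Set.mem_ofPred_eq, Set.indicator_of_notMem hnot, nonpos_iff_eq_zero,
      ENNReal.ofReal_eq_zero] at hω
    exact hω.not_gt hr
  rw [Set.mem_ofPred_eq, Set.indicator_of_mem hmem] at hω
  by_contra hdev
  have hsmall (p : ℤ) (hp : 1 ≤ p) (hp' : p ≤ n + 1) (hpr : r ≤ |(p : ℝ) - τ.cp k|) :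
      |psum (noiseVec ε ω).ofLp p - psum (noiseVec ε ω).ofLp (τ.cp k)| ≤
        1 / 16 * |μ k.succ - μ k.castSucc| * |(p : ℝ) - τ.cp k| := by
    rw [← one_mul (1 / 16 * _)]
    exact not_lt.1 fun hlt => hdev ⟨p, hp, hp', hpr, hlt⟩
  exact ((hτhat ω).dist1_lt (h.jumpWindow hrep hκ hL hLκ hq hr hmem hsmall)).not_ge hω

end HighEnergy

end ChangePoint

end

theorem proposition5 :
    ∃ (L₀ q₀ c c' : ℝ) (κ : ℝ → ℝ), 1 < L₀ ∧ 0 < q₀ ∧ 0 < c ∧ 0 < c' ∧ (∀ L, 1 < κ L) ∧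
      ∀ (L q : ℝ), L₀ ≤ L → q₀ < q →
      ∀ (n : ℕ) (θ : EuclideanSpace ℝ (Fin n)) (τ : ChangePoint.CPVector n)
        (μ : Fin (τ.len + 1) → ℝ), ChangePoint.IsChangePointRep θ τ μ →
      ∀ k : Fin τ.len, ChangePoint.IsHighEnergy (κ L) q θ τ k →
      ∀ (Ω : Type*) [MeasurableSpace Ω] (P : Measure Ω) [IsProbabilityMeasure P]
        (ε : Fin n → Ω → ℝ), (∀ i, Measurable (ε i)) → iIndepFun ε P →
        (∀ i, ∫ ω, ε i ω ∂P = 0) → (∀ i, HasSubgaussianMGF (ε i) 1 P) →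
      ∀ τhat : Ω → ChangePoint.CPVector n,
        (∀ ω, ChangePoint.IsPenalizedLSE L q (θ + ChangePoint.noiseVec ε ω) (τhat ω)) →
      ∀ x : ℝ, 1 ≤ x →
        P {ω | ENNReal.ofReal (c * x / (μ k.succ - μ k.castSucc) ^ 2) ≤
            (ChangePoint.noiseEvent ε q).indicator (fun ω => (τhat ω).dist1 (τ.cp k)) ω} ≤
          ENNReal.ofReal (c' * Real.exp (-x)) := by
  refine ⟨100, 10, 512, 4, fun L => 1000 * (1 + |L|), by norm_num, by norm_num, by norm_num,
    by norm_num, fun L => by linarith [abs_nonneg L], ?_⟩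
  intro L q hL hq n θ τ μ hrep k hE Ω _ P _ ε hε hind _ hsub τhat hopt x hx
  have hΔ : 0 < (μ k.succ - μ k.castSucc) ^ 2 := sq_pos_of_ne_zero (sub_ne_zero.2 (hrep.1 k).symm)
  have hr : 0 < 512 * x / (μ k.succ - μ k.castSucc) ^ 2 := by positivity
  have hκ : 1000000 * L ≤ (1000 * (1 + |L|)) ^ 2 := by nlinarith [le_abs_self L]
  have hrate : (μ k.succ - μ k.castSucc) ^ 2 / 512 *
      (512 * x / (μ k.succ - μ k.castSucc) ^ 2) = x := by
    rw [div_mul_div_comm, mul_left_comm, mul_div_mul_left _ _ (by norm_num : (512 : ℝ) ≠ 0)]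
    exact mul_div_cancel_left₀ x hΔ.ne'
  have h := hE.measure_le_dist1_le hrep (by positivity) hL hκ hq hε hind hsub hopt hr
  rwa [hrate] at h
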